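/- All Banach spaces are over the complex field; $\mathcal{B}(X)$ denotes the algebra of bounded linear operators on $X$, "isomorphic" means linearly homeomorphic, and a subspace of $X$ is complemented if it is the range of a bounded projection on $X$. A Banach space $X$ is complementably minimal if every closed infinite-dimensional subspace of $X$ contains a subspace which is complemented in $X$ and isomorphic to $X$. A Banach space $X$ has the SHAI property if for every non-zero Banach space $Y$ every surjective (not necessarily continuous) algebra homomorphism $\psi : \mathcal{B}(X) \to \mathcal{B}(Y)$ is injective. Schlumprecht's space $\mathbf{S}$ is the completion of the space $c_{00}$ of finitely supported complex sequences with respect to the norm $\|x\| = \sup_{k \ge 0} |x|_k$, where $|x|_0 = \max_n |x_n|$ and $$|x|_{k+1} = \sup\Big\{ \frac{1}{\log_2(\ell+1)} \sum_{i=1}^{\ell} |E_i x|_k : \ \ell \ge 1,\ E_1 < E_2 < \dots < E_\ell \text{ finite sets of natural numbers} \Big\};$$ here $Ex$ denotes the sequence which agrees with $x$ on $E$ and vanishes off $E$, and $E_1 < \dots < E_\ell$ means that $a < b$ whenever $a \in E_i$, $b \in E_j$ and $i < j$. Theorem. Let $X$ be a complementably minimal Banach space which has a complemented subspace isomorphic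 to $X \oplus X$. Then $X$ has the SHAI property. In particular, Schlumprecht's arbitrarily distortable Banach space $\mathbf{S}$ has the SHAI property. -/

import Mathlib

universe u v

/-- A Banach space `X` has the SHAI property if every surjective algebra homomorphism from
`𝓑(X)` onto `𝓑(Y)`, with `Y` a non-zero Banach space, is injective.  Homomorphisms are required
neither to be unital nor to be continuous. -/
def HasSHAI (X : Type u) [NormedAddCommGroup X] [NormedSpace ℂ X] : Prop :=
  ∀ (Y : Type v) [NormedAddCommGroup Y] [NormedSpace ℂ Y] [CompleteSpace Y] [Nontrivial Y]
    (ψ : (X →L[ℂ] X) →ₙₐ[ℂ] (Y →L[ℂ] Y)),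
    Function.Surjective ψ → Function.Injective ψ

/-- Every closed infinite-dimensional subspace of `X` contains a subspace which is complemented
in `X` (the range of a bounded projection on `X`) and isomorphic to `X`. -/
def ComplementablyMinimal (X : Type u) [NormedAddCommGroup X] [NormedSpace ℂ X] : Prop :=
  ∀ W : Submodule ℂ X, IsClosed (W : Set X) → ¬ FiniteDimensional ℂ W →
    ∃ Z : Submodule ℂ X, Z ≤ W ∧ Z.ClosedComplemented ∧ Nonempty (Z ≃L[ℂ] X)

/-- `X` has a complemented subspace isomorphic to `X ⊕ X`. -/
def HasComplementedSquare (X : Type u) [NormedAddCommGroup X] [NormedSpace ℂ X] : Prop :=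
  ∃ Z : Submodule ℂ X, Z.ClosedComplemented ∧ Nonempty (Z ≃L[ℂ] (X × X))

namespace Schlumprecht

/-- A family `E₁ < E₂ < ⋯ < E_ℓ`, `ℓ ≥ 1`, of successive finite sets of natural numbers
(some of the sets may be empty). -/
structure SuccessiveSets where
  card : ℕ
  one_le_card : 1 ≤ card
  set : Fin card → Finset ℕ
  lt_of_lt : ∀ i j, i < j → ∀ a ∈ set i, ∀ b ∈ set j, a < b

noncomputable section

/-- The function `f(ℓ) = log₂ (ℓ + 1)`. -/
def f (l : ℕ) : ℝ := Real.logb 2 ((l : ℝ) + 1)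

/-- The coordinate restriction `E x` of `x ∈ c₀₀`. -/
def restrict (E : Finset ℕ) (x : ℕ →₀ ℂ) : ℕ →₀ ℂ := x.filter (fun n => n ∈ E)

/-- The norms `|x|₀ = maxₙ |xₙ|` and
`|x|ₖ₊₁ = sup { f(ℓ)⁻¹ ∑ᵢ |Eᵢ x|ₖ : ℓ ≥ 1, E₁ < ⋯ < E_ℓ }` on `c₀₀`. -/
def iterNorm : ℕ → (ℕ →₀ ℂ) → ℝ
  | 0, x => ⨆ n, ‖x n‖
  | k + 1, x => ⨆ E : SuccessiveSets, (∑ i, iterNorm k (restrict (E.set i) x)) / f E.card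

/-- Schlumprecht's norm `‖x‖ = supₖ |x|ₖ` on `c₀₀`. -/
def schlumprechtNorm (x : ℕ →₀ ℂ) : ℝ := ⨆ k, iterNorm k x

/-- The `ℓ₁`-norm on `c₀₀`, used only to see that the suprema above are finite. -/
def l1 (x : ℕ →₀ ℂ) : ℝ := ∑ n ∈ x.support, ‖x n‖

instance instNonemptySuccessiveSets : Nonempty SuccessiveSets :=
  ⟨⟨1, le_rfl, fun _ => ∅, fun _ _ _ a ha => by simp at ha⟩⟩

lemma one_le_f {l : ℕ} (hl : 1 ≤ l) : 1 ≤ f l := by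
  have h : (1 : ℝ) ≤ l := by exact_mod_cast hl
  rw [f, Real.le_logb_iff_rpow_le (by norm_num) (by linarith)]
  simpa using by linarith

lemma iterNorm_nonneg (k : ℕ) (x : ℕ →₀ ℂ) : 0 ≤ iterNorm k x := by
  induction k generalizing x with
  | zero => exact Real.iSup_nonneg fun n => norm_nonneg _
  | succ k ih =>
    exact Real.iSup_nonneg fun E =>
      div_nonneg (Finset.sum_nonneg fun i _ => ih _) (zero_le_one.trans (one_le_f E.one_le_card))

lemma norm_le_l1 (x : ℕ →₀ ℂ) (n : ℕ) : ‖x n‖ ≤ l1 x := by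
  by_cases h : n ∈ x.support
  · exact Finset.single_le_sum (f := fun n => ‖x n‖) (fun i _ => norm_nonneg _) h
  · rw [Finsupp.notMem_support_iff.1 h, norm_zero]
    exact Finset.sum_nonneg fun i _ => norm_nonneg _

lemma l1_restrict (E : Finset ℕ) (x : ℕ →₀ ℂ) :
    l1 (restrict E x) = ∑ n ∈ x.support, if n ∈ E then ‖x n‖ else 0 := by
  rw [l1, restrict, Finsupp.support_filter, Finset.sum_filter]
  refine Finset.sum_congr rfl fun n _ => ?_
  by_cases h : n ∈ E <;> simp [h]

lemma sum_l1_restrict_le (E : SuccessiveSets) (x : ℕ →₀ ℂ) :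
    ∑ i, l1 (restrict (E.set i) x) ≤ l1 x := by
  simp only [l1_restrict]
  rw [Finset.sum_comm]
  refine Finset.sum_le_sum fun n _ => ?_
  by_cases h : ∃ i, n ∈ E.set i
  · obtain ⟨i, hi⟩ := h
    rw [Finset.sum_eq_single i]
    · simp [hi]
    · intro j _ hj
      rw [if_neg]
      intro hn
      rcases lt_or_gt_of_ne hj with hlt | hlt
      · exact lt_irrefl _ (E.lt_of_lt _ _ hlt n hn n hi)
      · exact lt_irrefl _ (E.lt_of_lt _ _ hlt n hi n hn)
    · simp
  · push Not at h
    simp [h]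

lemma l1_nonneg (x : ℕ →₀ ℂ) : 0 ≤ l1 x := Finset.sum_nonneg fun _ _ => norm_nonneg _

lemma term_le_l1 {k : ℕ} (ih : ∀ x, iterNorm k x ≤ l1 x) (x : ℕ →₀ ℂ) (E : SuccessiveSets) :
    (∑ i, iterNorm k (restrict (E.set i) x)) / f E.card ≤ l1 x := by
  have h1 := one_le_f E.one_le_card
  rw [div_le_iff₀ (by linarith)]
  calc ∑ i, iterNorm k (restrict (E.set i) x)
      ≤ ∑ i, l1 (restrict (E.set i) x) := Finset.sum_le_sum fun i _ => ih _
    _ ≤ l1 x := sum_l1_restrict_le E x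
    _ ≤ l1 x * f E.card := le_mul_of_one_le_right (l1_nonneg x) h1

lemma iterNorm_le_l1 (k : ℕ) (x : ℕ →₀ ℂ) : iterNorm k x ≤ l1 x := by
  induction k generalizing x with
  | zero => exact ciSup_le fun n => norm_le_l1 x n
  | succ k ih => exact ciSup_le fun E => term_le_l1 ih x E

lemma bddAbove_zero (x : ℕ →₀ ℂ) : BddAbove (Set.range fun n => ‖x n‖) :=
  ⟨l1 x, by rintro _ ⟨n, rfl⟩; exact norm_le_l1 x n⟩

lemma bddAbove_succ (k : ℕ) (x : ℕ →₀ ℂ) : BddAbove (Set.range fun E : SuccessiveSets =>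
    (∑ i, iterNorm k (restrict (E.set i) x)) / f E.card) :=
  ⟨l1 x, by rintro _ ⟨E, rfl⟩; exact term_le_l1 (iterNorm_le_l1 k) x E⟩

lemma bddAbove_iterNorm (x : ℕ →₀ ℂ) : BddAbove (Set.range fun k => iterNorm k x) :=
  ⟨l1 x, by rintro _ ⟨k, rfl⟩; exact iterNorm_le_l1 k x⟩

lemma iterNorm_add_le (k : ℕ) (x y : ℕ →₀ ℂ) :
    iterNorm k (x + y) ≤ iterNorm k x + iterNorm k y := by
  induction k generalizing x y with
  | zero =>
    refine ciSup_le fun n => (norm_add_le (x n) (y n)).trans ?_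
    exact add_le_add (le_ciSup (bddAbove_zero x) n) (le_ciSup (bddAbove_zero y) n)
  | succ k ih =>
    refine ciSup_le fun E => le_trans ?_
      (add_le_add (le_ciSup (bddAbove_succ k x) E) (le_ciSup (bddAbove_succ k y) E))
    rw [← add_div, ← Finset.sum_add_distrib]
    have h1 := one_le_f E.one_le_card
    refine div_le_div_of_nonneg_right (Finset.sum_le_sum fun i _ => ?_) (by linarith)
    rw [restrict, Finsupp.filter_add]
    exact ih _ _

lemma iterNorm_smul (k : ℕ) (c : ℂ) (x : ℕ →₀ ℂ) :
    iterNorm k (c • x) = ‖c‖ * iterNorm k x := by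
  induction k generalizing x with
  | zero =>
    simp only [iterNorm, Finsupp.smul_apply, norm_smul]
    rw [Real.mul_iSup_of_nonneg (norm_nonneg c)]
  | succ k ih =>
    simp only [iterNorm]
    rw [Real.mul_iSup_of_nonneg (norm_nonneg c)]
    refine congrArg _ (funext fun E => ?_)
    rw [← mul_div_assoc, Finset.mul_sum]
    refine congrArg (· / f E.card) (Finset.sum_congr rfl fun i _ => ?_)
    rw [← ih, restrict, Finsupp.filter_smul, restrict]

/-- The space `c₀₀` of finitely supported complex sequences, to be given Schlumprecht's norm. -/
def C00 : Type := ℕ →₀ ℂ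

instance instAddCommGroupC00 : AddCommGroup C00 := inferInstanceAs (AddCommGroup (ℕ →₀ ℂ))

instance instModuleC00 : Module ℂ C00 := inferInstanceAs (Module ℂ (ℕ →₀ ℂ))

instance instNormC00 : Norm C00 := ⟨fun x => schlumprechtNorm x⟩

lemma c00_core : NormedSpace.Core ℂ C00 where
  norm_nonneg x := Real.iSup_nonneg fun k => iterNorm_nonneg k x
  norm_smul c x := by
    change (⨆ k, iterNorm k (c • (show ℕ →₀ ℂ from x))) = ‖c‖ * ⨆ k, iterNorm k x
    rw [Real.mul_iSup_of_nonneg (norm_nonneg c)]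
    exact congrArg _ (funext fun k => iterNorm_smul k c x)
  norm_triangle x y := ciSup_le fun k => (iterNorm_add_le k x y).trans
    (add_le_add (le_ciSup (bddAbove_iterNorm x) k) (le_ciSup (bddAbove_iterNorm y) k))
  norm_eq_zero_iff x := by
    constructor
    · intro h
      refine Finsupp.ext fun n => norm_le_zero_iff.1 ?_
      exact ((le_ciSup (bddAbove_zero x) n).trans (le_ciSup (bddAbove_iterNorm x) 0)).trans h.le
    · rintro rfl
      have h : ∀ k, iterNorm k 0 = 0 := fun k => by simpa using iterNorm_smul k 0 0
      change (⨆ k, iterNorm k 0) = 0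
      simp [h]

instance instNormedAddCommGroupC00 : NormedAddCommGroup C00 := NormedAddCommGroup.ofCore c00_core

instance instNormedSpaceC00 : NormedSpace ℂ C00 := NormedSpace.ofCore c00_core

end

end Schlumprecht

/-- Schlumprecht's (complex) space `𝐒`: the completion of `c₀₀` in Schlumprecht's norm. -/
abbrev SchlumprechtSpace : Type := UniformSpace.Completion Schlumprecht.C00

/-!
# The SHAI property of complementably minimal spaces and of Schlumprecht's space

**The general result.** Let `ψ : 𝓑(X) → 𝓑(Y)` be a surjective homomorphism that is not injective.
Then `ψ` kills the finite-rank operators, and `Y` is infinite-dimensional because `𝓑(X)`, and hence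
`𝓑(Y)`, contains one-sided inverses coming from the complemented copy of `X × X` in `X`. Lift a
rank-one projection of `Y`, fixing a vector `y ≠ 0`, to some `S` in `𝓑(X)`. If `S` is bounded below
on an infinite-dimensional closed subspace, complementable minimality factors the identity of `X`
through `S`, and the identity of `Y` factors through a rank-one operator: impossible. If `S` is
strictly singular, then `1 - S` is a finite-rank perturbation of an invertible operator
(`IsStrictlySingular.isIndexZero_one_sub`), so `ψ (1 - S)` is invertible although it kills `y`:
impossible again. The property of having index zero is propagated along the segment `1 - t S`: it
is an open condition, and it is closed among operators which are bounded below on a closed subspace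
of finite codimension (`IsIndexZero.of_mem_closure`).

**Schlumprecht's space.** The square is obtained from the even and the odd unit vectors
(`Schlumprecht.hasComplementedSquare`); boundedness of the operators involved follows from the
domination principle `schlumprechtNorm_le_of_norm_apply_le`: if the pieces of `x` on successive
sets `E i` have norms at least `‖b i‖`, then `‖b‖ ≤ ‖x‖`.

For complementable minimality, let `W` be infinite-dimensional. A gliding hump and James's argument
produce, arbitrarily close to `W`, normalized blocks `y i` which are `ℓ₁`-averages of rapidly
increasing lengths (`exists_isRapid_near`). The domination principle, applied to norming functionals
of the `y i`, bounds the coefficient map `∑ aᵢ yᵢ ↦ a`; so it remains to prove the upper estimate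
`‖∑ aᵢ yᵢ‖ ≤ C ‖a‖` (`IsRapid.schlumprechtNorm_comb_le`). A perturbation of the `y i` into `W` then
gives a copy of the space inside `W` together with a projection onto it.

The upper estimate is proved by induction on the level of the norm. The induction hypothesis is that
`|∑ aᵢ yᵢ|ₖ` is bounded by a multiple of `‖D a‖ + ∑ ω ‖E a‖`, the sum being over successive sets `E`
with weights `ω`, of which at most `2 ^ (20 √(Y / u))` are above the level `u`. In an average over
`l` successive sets, the `y i` of length less than `l` are harmless, those met by several of the
sets are few and count as single coordinates, and the others are treated by the induction hypothesis.
If `f l ≤ Y`, then dividing the weights by `f l` gives a family of the same type. If `f l > Y`, the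
whole family may be replaced by a single set, at the cost of increasing the constant by the factor
`1 + O(1 / √(f l))`; since this is compensated by a constant `1 + 328 / √Y` decreasing in `Y`, the
factors do not accumulate.
-/

open Topology

/-! ### Operators of index zero -/

section IndexZero

variable {X : Type u} [NormedAddCommGroup X] [NormedSpace ℂ X]

/-- `A` is Fredholm of index zero, encoded as: `A` is a finite-rank perturbation of an invertible
operator. -/
def IsIndexZero (A : X →L[ℂ] X) : Prop :=
  ∃ F : X →L[ℂ] X, (F : X →ₗ[ℂ] X).HasFiniteRange ∧ IsUnit (A + F)

/-- The Fredholm alternative for finite-rank perturbations of the identity, reduced to the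
finite-dimensional range of `G`. -/
lemma injective_iff_surjective_one_sub {V : Type*} [AddCommGroup V] [Module ℂ V]
    {G : V →ₗ[ℂ] V} (hG : G.HasFiniteRange) :
    Function.Injective (1 - G : V →ₗ[ℂ] V) ↔ Function.Surjective (1 - G : V →ₗ[ℂ] V) := by
  have hfin : FiniteDimensional ℂ G.range :=
    Module.Finite.iff_fg.2 (LinearMap.hasFiniteRange_iff_range.1 hG)
  have hmaps : ∀ x ∈ G.range, (1 - G : V →ₗ[ℂ] V) x ∈ G.range := fun x hx => by
    simpa using G.range.sub_mem hx ⟨x, rfl⟩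
  have key := LinearMap.injective_iff_surjective (f := (1 - G).restrict hmaps)
  constructor
  · intro hinj y
    have h1 : Function.Injective ((1 - G).restrict hmaps) := fun a b hab =>
      Subtype.ext (hinj (congrArg Subtype.val hab))
    obtain ⟨⟨r, hr⟩, hry⟩ := key.1 h1 ⟨G y, y, rfl⟩
    have hry' : r - G r = G y := congrArg Subtype.val hry
    refine ⟨y + r, ?_⟩
    simp only [LinearMap.sub_apply, Module.End.one_apply, map_add]
    rw [← hry']; abel
  · intro hsurj
    have h1 : Function.Surjective ((1 - G).restrict hmaps) := by
      rintro ⟨r, hr⟩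
      obtain ⟨x, hx⟩ := hsurj r
      have hx' : x - G x = r := hx
      refine ⟨⟨x, ?_⟩, Subtype.ext hx⟩
      rw [sub_eq_iff_eq_add.1 hx']
      exact G.range.add_mem hr ⟨x, rfl⟩
    rw [← LinearMap.ker_eq_bot, LinearMap.ker_eq_bot']
    intro x hx
    have hx' : x - G x = 0 := hx
    have hxG : x ∈ G.range := ⟨x, (sub_eq_zero.1 hx').symm⟩
    have := key.2 h1 (a₁ := ⟨x, hxG⟩) (a₂ := 0) (Subtype.ext (by simpa using hx'))
    simpa using congrArg Subtype.val this

lemma IsIndexZero.of_isUnit {A : X →L[ℂ] X} (h : IsUnit A) : IsIndexZero A :=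
  ⟨0, by simp, by simpa using h⟩

lemma IsIndexZero.add_finiteRange {A G : X →L[ℂ] X} (hA : IsIndexZero A)
    (hG : (G : X →ₗ[ℂ] X).HasFiniteRange) : IsIndexZero (A + G) := by
  obtain ⟨F, hF, hu⟩ := hA
  refine ⟨F - G, ?_, by simpa using hu⟩
  rw [ContinuousLinearMap.toLinearMap_sub]
  exact hF.sub hG

lemma IsIndexZero.injective_iff_surjective {A : X →L[ℂ] X} (hA : IsIndexZero A) :
    Function.Injective A ↔ Function.Surjective A := by
  obtain ⟨F, hF, u, hu⟩ := hA
  have hG : ((↑u⁻¹ * F : X →L[ℂ] X) : X →ₗ[ℂ] X).HasFiniteRange :=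
    hF.comp_left ((↑u⁻¹ : X →L[ℂ] X) : X →ₗ[ℂ] X)
  have hiso : ∀ x, (↑u⁻¹ : X →L[ℂ] X) ((u : X →L[ℂ] X) x) = x := fun x =>
    DFunLike.congr_fun u.inv_mul x
  have hiso' : ∀ x, (u : X →L[ℂ] X) ((↑u⁻¹ : X →L[ℂ] X) x) = x := fun x =>
    DFunLike.congr_fun u.mul_inv x
  have hbij : Function.Bijective (u : X →L[ℂ] X) :=
    ⟨Function.LeftInverse.injective hiso, Function.RightInverse.surjective hiso'⟩
  have hfac : (A : X → X) = (u : X →L[ℂ] X) ∘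
      (1 - ((↑u⁻¹ * F : X →L[ℂ] X) : X →ₗ[ℂ] X) : X →ₗ[ℂ] X) := by
    funext x
    have h2 : (u : X →L[ℂ] X) x = A x + F x := by rw [hu]; rfl
    simp [hiso', h2]
  rw [hfac, hbij.injective.of_comp_iff, injective_iff_surjective_one_sub hG]
  exact ⟨hbij.surjective.comp, fun h => Function.Surjective.of_comp_left h hbij.injective⟩

end IndexZero

section IndexStability

variable {X : Type u} [NormedAddCommGroup X] [NormedSpace ℂ X] [CompleteSpace X]

lemma isUnit_of_bijective {A : X →L[ℂ] X} (h : Function.Bijective A) : IsUnit A :=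
  ContinuousLinearMap.isUnit_iff_bijective.2 h

lemma IsIndexZero.isUnit_of_injective {A : X →L[ℂ] X} (hA : IsIndexZero A)
    (h : Function.Injective A) : IsUnit A :=
  isUnit_of_bijective ⟨h, hA.injective_iff_surjective.1 h⟩

lemma IsIndexZero.isUnit_of_surjective {A : X →L[ℂ] X} (hA : IsIndexZero A)
    (h : Function.Surjective A) : IsUnit A :=
  isUnit_of_bijective ⟨hA.injective_iff_surjective.2 h, h⟩

lemma isOpen_isIndexZero : IsOpen {A : X →L[ℂ] X | IsIndexZero A} := by
  rw [isOpen_iff_mem_nhds]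
  rintro A ⟨F, hF, hu⟩
  have hcont : Filter.Tendsto (fun B : X →L[ℂ] X => B + F) (𝓝 A) (𝓝 (A + F)) :=
    (continuous_id.add continuous_const).tendsto A
  filter_upwards [hcont (Units.isOpen.mem_nhds hu)] with B hB
  exact ⟨F, hF, hB⟩

/-- A limit of index-zero operators which is bounded below is invertible. -/
lemma isUnit_of_mem_closure_of_le_norm {A : X →L[ℂ] X} {c : ℝ} (hc : 0 < c)
    (hA : ∀ x, c * ‖x‖ ≤ ‖A x‖) (hcl : A ∈ closure {B : X →L[ℂ] X | IsIndexZero B}) :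
    IsUnit A := by
  obtain ⟨B, hB, hAB⟩ := Metric.mem_closure_iff.1 hcl (c / 4) (by positivity)
  rw [dist_eq_norm] at hAB
  have hBlow : ∀ x, (c / 2) * ‖x‖ ≤ ‖B x‖ := fun x => by
    have h1 : ‖(A - B) x‖ ≤ c / 4 * ‖x‖ :=
      ((A - B).le_opNorm x).trans (by gcongr)
    have h2 : ‖A x‖ ≤ ‖(A - B) x‖ + ‖B x‖ := by
      have : A x = (A - B) x + B x := by simp
      rw [this]; exact norm_add_le _ _
    have := hA x
    nlinarith [norm_nonneg x]
  have hBinj : Function.Injective B := by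
    rw [injective_iff_map_eq_zero]
    intro x hx
    have := hBlow x
    rw [hx, norm_zero] at this
    exact norm_le_zero_iff.1 (by nlinarith [norm_nonneg x])
  obtain ⟨u, rfl⟩ := IsIndexZero.isUnit_of_injective hB hBinj
  rcases subsingleton_or_nontrivial X with hX | hX
  · exact isUnit_of_bijective
      ⟨fun _ _ _ => Subsingleton.elim _ _, fun y => ⟨0, Subsingleton.elim _ _⟩⟩
  have hinv : ‖(↑u⁻¹ : X →L[ℂ] X)‖ ≤ 2 / c := by
    refine ContinuousLinearMap.opNorm_le_bound _ (by positivity) fun x => ?_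
    have h1 := hBlow ((↑u⁻¹ : X →L[ℂ] X) x)
    have h2 : (u : X →L[ℂ] X) ((↑u⁻¹ : X →L[ℂ] X) x) = x := DFunLike.congr_fun u.mul_inv x
    rw [h2] at h1
    rw [div_mul_eq_mul_div, le_div_iff₀ hc]; linarith
  have hpos : 0 < ‖(↑u⁻¹ : X →L[ℂ] X)‖ := norm_pos_iff.2 u⁻¹.ne_zero
  refine ⟨Units.ofNearby u A (hAB.trans ?_), rfl⟩
  rw [lt_inv_comm₀ (by positivity) hpos]
  refine hinv.trans_lt ?_
  rw [div_lt_iff₀ hc, inv_mul_eq_div, lt_div_iff₀ (by positivity)]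
  linarith

/-- A limit of index-zero operators cannot be surjective with a non-trivial complemented kernel. -/
lemma injective_of_mem_closure_of_hasRightInverse {A : X →L[ℂ] X} (hA : A.HasRightInverse)
    (hcl : A ∈ closure {B : X →L[ℂ] X | IsIndexZero B}) : Function.Injective A := by
  obtain ⟨R, hR⟩ := hA
  have hAR : A * R = 1 := by ext x; exact hR x
  have hcont : Filter.Tendsto (fun B : X →L[ℂ] X => B * R) (𝓝 A) (𝓝 (A * R)) :=
    (continuous_id.mul continuous_const).tendsto A
  rw [hAR] at hcont
  obtain ⟨B, ⟨v, hv⟩, hB⟩ := mem_closure_iff_nhds.1 hcl _ (hcont (Units.isOpen.mem_nhds isUnit_one))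
  -- `B` is surjective, hence invertible, and so is `R = B⁻¹ (B R)`.
  have hv' : (v : X →L[ℂ] X) = B * R := hv
  have hBsurj : Function.Surjective B := fun y => by
    refine ⟨R ((↑v⁻¹ : X →L[ℂ] X) y), ?_⟩
    have := DFunLike.congr_fun v.mul_inv y
    rw [hv'] at this
    exact this
  obtain ⟨w, rfl⟩ := IsIndexZero.isUnit_of_surjective hB hBsurj
  have hRu : IsUnit R := ⟨w⁻¹ * v, by rw [Units.val_mul, hv']; simp⟩
  obtain ⟨r, rfl⟩ := hRu
  have : A = ↑r⁻¹ := by rw [← mul_one A, ← r.mul_inv, ← mul_assoc, hAR, one_mul]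
  rw [this]
  exact Function.LeftInverse.injective (g := (r : X →L[ℂ] X))
    fun x => DFunLike.congr_fun r.mul_inv x

lemma hasRightInverse_of_surjective {A : X →L[ℂ] X} (hA : Function.Surjective A)
    (hker : A.ker.ClosedComplemented) : A.HasRightInverse := by
  obtain ⟨C, hC, hcompl⟩ := hker.exists_isClosed_isCompl
  have : CompleteSpace C := hC.completeSpace_coe
  have hinj : Function.Injective (A.domRestrict C) := by
    rw [injective_iff_map_eq_zero]
    intro x hx
    exact Subtype.ext (Submodule.disjoint_def.1 hcompl.disjoint x hx x.2)
  have hsurj : Function.Surjective (A.domRestrict C) := by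
    intro y
    obtain ⟨x, rfl⟩ := hA y
    have hx : x ∈ A.ker ⊔ C := by rw [hcompl.sup_eq_top]; trivial
    obtain ⟨k, hk, m, hm, rfl⟩ := Submodule.mem_sup.1 hx
    have hk' : A k = 0 := hk
    exact ⟨⟨m, hm⟩, by simp [hk']⟩
  let e := ContinuousLinearEquiv.ofBijective (A.domRestrict C) (LinearMap.ker_eq_bot.2 hinj)
    (LinearMap.range_eq_top.2 hsurj)
  exact ⟨C.subtypeL.comp (e.symm : X →L[ℂ] C), fun y => e.apply_symm_apply y⟩

lemma exists_injective_or_surjective (K V : Type u) [AddCommGroup K] [Module ℂ K]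
    [FiniteDimensional ℂ K] [AddCommGroup V] [Module ℂ V] :
    ∃ f : K →ₗ[ℂ] V, Function.Injective f ∨
      (Function.Surjective f ∧ ∃ k, k ≠ 0 ∧ f k = 0) := by
  by_cases h : Module.rank ℂ K ≤ Module.rank ℂ V
  · obtain ⟨f, hf⟩ := rank_le_iff_exists_linearMap.1 h
    exact ⟨f, Or.inl hf⟩
  · push Not at h
    obtain ⟨g, hg⟩ := rank_le_iff_exists_linearMap.1 h.le
    obtain ⟨f, hf⟩ := g.exists_leftInverse_of_injective (LinearMap.ker_eq_bot.2 hg)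
    have hsurj : Function.Surjective f := fun y => ⟨g y, DFunLike.congr_fun hf y⟩
    refine ⟨f, Or.inr ⟨hsurj, ?_⟩⟩
    by_contra! hk
    have hinj : Function.Injective f := by
      rw [injective_iff_map_eq_zero]
      intro k hfk
      by_contra hk0
      exact hk k hk0 hfk
    exact absurd (LinearMap.rank_le_of_injective f hinj) (not_le.2 h)

/-- Stability of the index: a limit of index-zero operators which is bounded below on a closed
subspace of finite codimension has index zero. -/
lemma IsIndexZero.of_mem_closure {A : X →L[ℂ] X} {H : Submodule ℂ X} (hH : IsClosed (H : Set X))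
    [H.CoFG] {c : ℝ} (hc : 0 < c) (hA : ∀ x ∈ H, c * ‖x‖ ≤ ‖A x‖)
    (hcl : A ∈ closure {B : X →L[ℂ] X | IsIndexZero B}) : IsIndexZero A := by
  have : CompleteSpace H := hH.completeSpace_coe
  have hanti : AntilipschitzWith (Real.toNNReal c⁻¹) (A.domRestrict H) := by
    refine AddMonoidHomClass.antilipschitz_of_bound _ fun x => ?_
    rw [Real.coe_toNNReal _ (by positivity), inv_mul_eq_div, le_div_iff₀ hc, mul_comm]
    exact hA x x.2
  have hstrict : Topology.IsStrictMap A ∧ IsClosed (A.range : Set X) := by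
    rw [A.isStrictMap_isClosed_range_iff_restrict H hH]
    have hemb := hanti.isClosedEmbedding (A.domRestrict H).uniformContinuous
    exact ⟨hemb.isEmbedding.isStrictMap, by rw [LinearMap.coe_range]; exact hemb.isClosed_range⟩
  have hdisj : Disjoint A.ker H := by
    rw [Submodule.disjoint_def]
    intro x hx hxH
    have h := hA x hxH
    rw [show A x = 0 from hx, norm_zero] at h
    exact norm_le_zero_iff.1 (by nlinarith [norm_nonneg x])
  have hK : FiniteDimensional ℂ A.ker :=
    Module.Finite.iff_fg.2 ((inferInstance : H.CoFG).fg_of_disjoint hdisj)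
  obtain ⟨P, hP⟩ := Submodule.ClosedComplemented.of_finiteDimensional A.ker
  obtain ⟨g, hg⟩ := exists_injective_or_surjective A.ker (X ⧸ A.range)
  obtain ⟨φ, hφ⟩ := Module.projective_lifting_property A.range.mkQ g A.range.mkQ_surjective
  have hφ' : ∀ k, A.range.mkQ (φ k) = g k := fun k => DFunLike.congr_fun hφ k
  set F : X →L[ℂ] X := (LinearMap.toContinuousLinearMap φ).comp P with hF
  have hFapp : ∀ x, F x = φ (P x) := fun x => rfl
  have hFfin : (F : X →ₗ[ℂ] X).HasFiniteRange :=
    (LinearMap.HasFiniteRange.of_finite_dom (f := φ)).comp_right (P : X →ₗ[ℂ] A.ker)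
  have hclF : A + F ∈ closure {B : X →L[ℂ] X | IsIndexZero B} := by
    have hc : Continuous fun B : X →L[ℂ] X => B + F := continuous_id.add continuous_const
    refine closure_mono ?_ (image_closure_subset_closure_image hc ⟨A, hcl, rfl⟩)
    rintro _ ⟨B, hB, rfl⟩
    exact IsIndexZero.add_finiteRange hB hFfin
  have hstrictF : Topology.IsStrictMap (A + F) ∧ IsClosed ((A + F).range : Set X) := by
    rwa [ContinuousLinearMap.isStrictMap_isClosed_range_iff_of_finiteRangeSetoid (A + F) A]
    rw [LinearMap.FiniteRangeSetoid.equiv_iff_hasFiniteRange]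
    simpa using hFfin
  -- `A + F` has closed range; it is injective or it is surjective with a non-trivial kernel,
  -- according to the comparison of the kernel of `A` with the cokernel.
  suffices hunit : IsUnit (A + F) from ⟨F, hFfin, hunit⟩
  have hAP : ∀ x, A (P x : X) = 0 := fun x => (P x).2
  rcases hg with hinj | ⟨hsurj, k, hk0, hk⟩
  · have hinjF : Function.Injective (A + F) := by
      rw [injective_iff_map_eq_zero]
      intro x hx
      have hx' : A x + φ (P x) = 0 := hx
      have h1 : g (P x) = 0 := by
        rw [← hφ', Submodule.mkQ_apply, Submodule.Quotient.mk_eq_zero,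
          eq_neg_of_add_eq_zero_right hx']
        exact A.range.neg_mem ⟨x, rfl⟩
      have h2 : P x = 0 := hinj (h1.trans (map_zero g).symm)
      have h3 : A x = 0 := by simpa [h2] using hx'
      simpa [h2] using congrArg Subtype.val (hP ⟨x, h3⟩).symm
    obtain ⟨L, hL⟩ := (A + F).antilipschitz_of_injective_of_isClosed_range hinjF
      (by have := hstrictF.2; rwa [LinearMap.coe_range] at this)
    refine isUnit_of_mem_closure_of_le_norm (c := (L + 1 : ℝ)⁻¹) (by positivity) (fun x => ?_) hclF
    have h1 := hL.le_mul_norm (map_zero _) x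
    rw [inv_mul_eq_div, div_le_iff₀ (by positivity)]
    nlinarith [norm_nonneg ((A + F) x)]
  · exfalso
    have hsurjF : Function.Surjective (A + F) := by
      intro y
      obtain ⟨l, hl⟩ := hsurj (A.range.mkQ y)
      rw [← hφ', Submodule.mkQ_apply, Submodule.mkQ_apply, eq_comm, Submodule.Quotient.eq] at hl
      obtain ⟨m, hm⟩ := hl
      have hm' : A m = y - φ l := hm
      refine ⟨m - P m + l, ?_⟩
      have hl' : A (l : X) = 0 := l.2
      simp [hFapp, hP, hm', hAP, hl']
    have hcofg : (P : X →ₗ[ℂ] A.ker).ker.CoFG := Submodule.CoFG.ker _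
    have hker : (A + F).ker.ClosedComplemented := by
      refine .of_disjoint_of_finiteDimensional_quotient (B := (P : X →ₗ[ℂ] A.ker).ker)
        P.isClosed_ker ?_
      rw [Submodule.disjoint_def]
      intro x hx hxP
      have hPx : P x = 0 := hxP
      have hx' : A x + φ (P x) = 0 := hx
      have h3 : A x = 0 := by simpa [hPx] using hx'
      simpa [hPx] using congrArg Subtype.val (hP ⟨x, h3⟩).symm
    have hinjF := injective_of_mem_closure_of_hasRightInverse
      (hasRightInverse_of_surjective hsurjF hker) hclF
    rw [← hφ', Submodule.mkQ_apply, Submodule.Quotient.mk_eq_zero] at hk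
    obtain ⟨m, hm⟩ := hk
    have hm' : A m = φ k := hm
    have hk' : A (k : X) = 0 := k.2
    have h0 : (A + F) ((k : X) - (m - P m)) = 0 := by
      simp [hFapp, hP, hm', hAP, hk']
    have h1 := (injective_iff_map_eq_zero (A + F)).1 hinjF _ h0
    have h2 := congrArg P h1
    simp [hP] at h2
    exact hk0 h2

end IndexStability

/-! ### Strictly singular perturbations of the identity -/

section StrictlySingular

variable {X : Type u} [NormedAddCommGroup X] [NormedSpace ℂ X]

/-- An operator is strictly singular if it is not bounded below on any closed
infinite-dimensional subspace. -/
def IsStrictlySingular (S : X →L[ℂ] X) : Prop :=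
  ∀ W : Submodule ℂ X, IsClosed (W : Set X) → ¬ FiniteDimensional ℂ W →
    ∀ c : ℝ, 0 < c → ∃ w ∈ W, ‖S w‖ < c * ‖w‖

/-- If `f n (x n) = 1` and `f n` kills `x i` for `i > n`, then the coefficients of a linear
combination of the `x n` grow at most geometrically relative to its norm. -/
lemma norm_coeff_le_of_triangular {x : ℕ → X} {f : ℕ → X →L[ℂ] ℂ}
    (hx : ∀ n, ‖x n‖ = 1) (hf : ∀ n, ‖f n‖ = 1) (hfx : ∀ n, f n (x n) = 1)
    (hfx0 : ∀ n i, n < i → f n (x i) = 0) (l : ℕ →₀ ℂ) (n : ℕ) :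
    ‖l n‖ ≤ 2 ^ n * ‖Finsupp.linearCombination ℂ x l‖ := by
  induction n using Nat.strong_induction_on with
  | _ n ih =>
    set z := Finsupp.linearCombination ℂ x l with hz
    obtain ⟨m, hm⟩ := l.support.exists_nat_subset_range
    have hz' : z = ∑ i ∈ Finset.range (n + 1 + m), l i • x i := by
      rw [hz, Finsupp.linearCombination_apply]
      refine Finsupp.sum_of_support_subset _ (hm.trans ?_) _ (by simp)
      exact Finset.range_subset_range.2 (by omega)
    have hfz : f n z = l n + ∑ i ∈ Finset.range n, l i * f n (x i) := by
      rw [hz', map_sum, Finset.sum_range_add, Finset.sum_range_succ]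
      have h0 : ∑ i ∈ Finset.range m, f n (l (n + 1 + i) • x (n + 1 + i)) = 0 :=
        Finset.sum_eq_zero fun i _ => by rw [map_smul, hfx0 n _ (by omega), smul_zero]
      rw [h0]
      simp [hfx, add_comm]
    have h1 : ‖f n z‖ ≤ ‖z‖ := by simpa [hf] using (f n).le_opNorm z
    have h2 : ‖∑ i ∈ Finset.range n, l i * f n (x i)‖ ≤ ∑ i ∈ Finset.range n, 2 ^ i * ‖z‖ := by
      refine norm_sum_le_of_le _ fun i hi => ?_
      rw [norm_mul]
      have h3 : ‖f n (x i)‖ ≤ 1 := by simpa [hf, hx] using (f n).le_opNorm (x i)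
      calc ‖l i‖ * ‖f n (x i)‖ ≤ ‖l i‖ * 1 := by gcongr
        _ ≤ 2 ^ i * ‖z‖ := by rw [mul_one]; exact ih i (Finset.mem_range.1 hi)
    have h4 : ∑ i ∈ Finset.range n, (2 : ℝ) ^ i * ‖z‖ = (2 ^ n - 1) * ‖z‖ := by
      rw [← Finset.sum_mul, geom_sum_eq (by norm_num)]; norm_num
    have h5 : l n = f n z - ∑ i ∈ Finset.range n, l i * f n (x i) := by rw [hfz]; ring
    calc ‖l n‖ ≤ ‖f n z‖ + ‖∑ i ∈ Finset.range n, l i * f n (x i)‖ := by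
          rw [h5]; exact norm_sub_le _ _
      _ ≤ ‖z‖ + (2 ^ n - 1) * ‖z‖ := by rw [← h4]; gcongr
      _ = 2 ^ n * ‖z‖ := by ring

/-- An operator that is bounded below on no closed subspace of finite codimension is almost zero
on a sequence of unit vectors in triangular position with respect to norm-one functionals. -/
lemma exists_triangular_of_not_bounded_below {A : X →L[ℂ] X}
    (h : ∀ H : Submodule ℂ X, IsClosed (H : Set X) → H.CoFG → ∀ c : ℝ, 0 < c →
      ∃ x ∈ H, ‖A x‖ < c * ‖x‖) (ε : ℕ → ℝ) (hε : ∀ n, 0 < ε n) (hanti : Antitone ε) :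
    ∃ (x : ℕ → X) (f : ℕ → X →L[ℂ] ℂ), (∀ n, ‖x n‖ = 1) ∧ (∀ n, ‖f n‖ = 1) ∧
      (∀ n, f n (x n) = 1) ∧ (∀ n i, n < i → f n (x i) = 0) ∧ ∀ n, ‖A (x n)‖ ≤ ε n := by
  obtain ⟨F, hP, hr⟩ := exists_seq_of_forall_finset_exists
    (fun a : ℕ × X × (X →L[ℂ] ℂ) =>
      ‖a.2.1‖ = 1 ∧ ‖a.2.2‖ = 1 ∧ a.2.2 a.2.1 = 1 ∧ ‖A a.2.1‖ ≤ ε a.1)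
    (fun a b => a.1 < b.1 ∧ a.2.2 b.2.1 = 0) (by
      intro s _
      let Φ : X →L[ℂ] (s → ℂ) := ContinuousLinearMap.pi fun a : s => a.1.2.2
      obtain ⟨N, hN⟩ := (s.image Prod.fst).exists_nat_subset_range
      obtain ⟨x, hxH, hx⟩ := h Φ.ker Φ.isClosed_ker (Submodule.CoFG.ker _) (ε N) (hε N)
      have hx0 : x ≠ 0 := by rintro rfl; simp at hx
      have hxn : (0 : ℝ) < ‖x‖ := norm_pos_iff.2 hx0
      have hy1 : ‖((‖x‖⁻¹ : ℝ) : ℂ) • x‖ = 1 := by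
        rw [norm_smul, Complex.norm_real, norm_inv, norm_norm, inv_mul_cancel₀ hxn.ne']
      obtain ⟨g, hg1, hg⟩ := exists_dual_vector ℂ (((‖x‖⁻¹ : ℝ) : ℂ) • x)
        (by rw [← norm_ne_zero_iff, hy1]; norm_num)
      rw [hy1] at hg
      refine ⟨⟨N, ((‖x‖⁻¹ : ℝ) : ℂ) • x, g⟩, ⟨hy1, hg1, by simpa using hg, ?_⟩, ?_⟩
      · change ‖A (((‖x‖⁻¹ : ℝ) : ℂ) • x)‖ ≤ ε N
        rw [map_smul, norm_smul, Complex.norm_real, norm_inv, norm_norm, inv_mul_le_iff₀ hxn,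
          mul_comm]
        exact hx.le
      · intro a ha
        refine ⟨Finset.mem_range.1 (hN (Finset.mem_image_of_mem _ ha)), ?_⟩
        have : a.2.2 x = 0 := congrFun (show Φ x = 0 from hxH) ⟨a, ha⟩
        change a.2.2 (((‖x‖⁻¹ : ℝ) : ℂ) • x) = 0
        rw [map_smul, this, smul_zero])
  have hidx : ∀ n, n ≤ (F n).1 := (strictMono_nat_of_lt_succ fun n =>
    (hr n (n + 1) n.lt_succ_self).1).id_le
  exact ⟨fun n => (F n).2.1, fun n => (F n).2.2, fun n => (hP n).1, fun n => (hP n).2.1,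
    fun n => (hP n).2.2.1, fun n i hi => (hr n i hi).2,
    fun n => (hP n).2.2.2.trans (hanti (hidx n))⟩

/-- If `S` is strictly singular, then `1 - t S` is bounded below on a closed subspace of finite
codimension. -/
lemma IsStrictlySingular.exists_bounded_below {S : X →L[ℂ] X} (hS : IsStrictlySingular S) (t : ℂ) :
    ∃ H : Submodule ℂ X, IsClosed (H : Set X) ∧ H.CoFG ∧ ∃ c : ℝ, 0 < c ∧
      ∀ x ∈ H, c * ‖x‖ ≤ ‖(1 - t • S : X →L[ℂ] X) x‖ := by
  by_contra! hcon
  set A : X →L[ℂ] X := 1 - t • S with hA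
  obtain ⟨x, f, hx, hf, hfx, hfx0, hAx⟩ := exists_triangular_of_not_bounded_below hcon
    (fun n => 1 / 4 * (1 / 4) ^ n) (fun n => by positivity) (fun m n hmn => by
      have : (1 / 4 : ℝ) ^ n ≤ (1 / 4) ^ m := pow_le_pow_of_le_one (by norm_num) (by norm_num) hmn
      simpa using this)
  have hcoeff := norm_coeff_le_of_triangular hx hf hfx hfx0
  have hsmall : ∀ l : ℕ →₀ ℂ, ‖A (Finsupp.linearCombination ℂ x l)‖ ≤
      1 / 2 * ‖Finsupp.linearCombination ℂ x l‖ := by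
    intro l
    obtain ⟨m, hm⟩ := l.support.exists_nat_subset_range
    set z := Finsupp.linearCombination ℂ x l with hz
    have hz' : z = ∑ i ∈ Finset.range m, l i • x i := by
      rw [hz, Finsupp.linearCombination_apply]
      exact Finsupp.sum_of_support_subset _ hm _ (by simp)
    have h1 : ‖A z‖ ≤ ∑ i ∈ Finset.range m, 1 / 4 * ‖z‖ * (1 / 2) ^ i := by
      rw [hz', map_sum, ← hz']
      refine norm_sum_le_of_le _ fun i _ => ?_
      rw [map_smul, norm_smul]
      calc ‖l i‖ * ‖A (x i)‖ ≤ (2 ^ i * ‖z‖) * (1 / 4 * (1 / 4) ^ i) := by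
            gcongr
            · exact hcoeff l i
            · exact hAx i
        _ = 1 / 4 * ‖z‖ * (1 / 2) ^ i := by
            rw [show (1 / 4 : ℝ) ^ i = (1 / 2) ^ i * (1 / 2) ^ i by rw [← mul_pow]; norm_num]
            have : (2 : ℝ) ^ i * (1 / 2) ^ i = 1 := by rw [← mul_pow]; norm_num
            linear_combination (1 / 4 * ‖z‖ * (1 / 2) ^ i) * this
    rw [← Finset.mul_sum, geom_sum_eq (by norm_num),
      show ((1 / 2 : ℝ) ^ m - 1) / (1 / 2 - 1) = 2 * (1 - (1 / 2) ^ m) by ring] at h1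
    have h2 : 0 ≤ ‖z‖ * (1 / 2) ^ m := by positivity
    linarith
  -- On the closed span of the `x n` the operator `t S = 1 - A` is bounded below.
  set W := (Submodule.span ℂ (Set.range x)).topologicalClosure with hW
  have hlow : ∀ w ∈ W, 1 / 2 * ‖w‖ ≤ ‖t‖ * ‖S w‖ := by
    have hcl : IsClosed {w : X | 1 / 2 * ‖w‖ ≤ ‖t‖ * ‖S w‖} :=
      isClosed_le (by fun_prop) (by fun_prop)
    intro w hw
    refine closure_minimal ?_ hcl hw
    intro z hz
    obtain ⟨l, rfl⟩ := (Finsupp.mem_span_range_iff_exists_finsupp).1 hz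
    have h1 := hsmall l
    rw [Finsupp.linearCombination_apply] at h1
    set z := l.sum fun i a => a • x i
    have h2 : z - A z = t • S z := by simp [hA]
    have h3 : ‖z‖ ≤ ‖A z‖ + ‖z - A z‖ := by
      have := norm_add_le (A z) (z - A z)
      simpa using this
    rw [h2, norm_smul] at h3
    change 1 / 2 * ‖z‖ ≤ ‖t‖ * ‖S z‖
    linarith
  have hli : LinearIndependent ℂ x := by
    rw [linearIndependent_iff]
    intro l hl
    ext n
    have := hcoeff l n
    rw [hl, norm_zero, mul_zero] at this
    simpa using this
  have hinf : ¬ FiniteDimensional ℂ W := by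
    intro hfd
    have hmem : ∀ n, x n ∈ W := fun n =>
      Submodule.le_topologicalClosure _ (Submodule.subset_span ⟨n, rfl⟩)
    have : LinearIndependent ℂ (fun n => (⟨x n, hmem n⟩ : W)) :=
      LinearIndependent.of_comp W.subtype hli
    exact absurd this.finite (not_finite_iff_infinite.2 inferInstance)
  obtain ⟨w, hwW, hw⟩ := hS W (Submodule.isClosed_topologicalClosure _) hinf
    (1 / (2 * (‖t‖ + 1))) (by positivity)
  have h1 := hlow w hwW
  rw [one_div_mul_eq_div, lt_div_iff₀ (by positivity)] at hw
  nlinarith [norm_nonneg (S w), norm_nonneg t]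

variable [CompleteSpace X]

/-- Strictly singular perturbations of the identity have index zero: the index is constant along
the segment of the operators `1 - t S`, `0 ≤ t ≤ 1`. -/
lemma IsStrictlySingular.isIndexZero_one_sub {S : X →L[ℂ] X} (hS : IsStrictlySingular S) :
    IsIndexZero (1 - S) := by
  let γ : ℝ → X →L[ℂ] X := fun t => 1 - (t : ℂ) • S
  have hγ : Continuous γ := by fun_prop
  have hopen : IsOpen {t | IsIndexZero (γ t)} := isOpen_isIndexZero.preimage hγ
  have hclosed : IsClosed {t | IsIndexZero (γ t)} := by
    refine isClosed_of_closure_subset fun t ht => ?_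
    obtain ⟨H, hH, hcofg, c, hc, hlow⟩ := hS.exists_bounded_below (t : ℂ)
    refine IsIndexZero.of_mem_closure hH hc hlow ?_
    exact closure_mono (Set.image_subset_iff.2 fun s hs => hs)
      (image_closure_subset_closure_image hγ ⟨t, ht, rfl⟩)
  have huniv := IsClopen.eq_univ ⟨hclosed, hopen⟩
    ⟨0, show IsIndexZero (γ 0) from .of_isUnit (by simp [γ])⟩
  have : (1 : ℝ) ∈ {t | IsIndexZero (γ t)} := huniv ▸ Set.mem_univ _
  simpa [γ] using this

end StrictlySingular

/-! ### Factoring the identity -/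

section Complemented

variable {X : Type u} [NormedAddCommGroup X] [NormedSpace ℂ X]
  {Y : Type v} [NormedAddCommGroup Y] [NormedSpace ℂ Y]

/-- The range of an operator with a bounded left inverse is complemented and isomorphic to the
domain. -/
lemma complemented_range_of_leftInverse (T : Y →L[ℂ] X) (V : X →L[ℂ] Y) (h : ∀ y, V (T y) = y) :
    T.range.ClosedComplemented ∧ Nonempty (T.range ≃L[ℂ] Y) := by
  refine ⟨ContinuousLinearMap.HasLeftInverse.closedComplemented_range ⟨V, h⟩, ⟨?_⟩⟩
  refine ContinuousLinearEquiv.equivOfInverse (V.comp T.range.subtypeL) T.rangeRestrict ?_ h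
  rintro ⟨_, y, rfl⟩
  exact Subtype.ext (congrArg T (h y))

/-- The coordinate embeddings `u₁, u₂` of `X` into a complemented copy of `X × X`, with the
coordinate projections `v₁, v₂`. -/
lemma HasComplementedSquare.exists_operators (h : HasComplementedSquare X) :
    ∃ u₁ u₂ v₁ v₂ : X →L[ℂ] X, v₁ * u₁ = 1 ∧ v₂ * u₂ = 1 ∧ v₁ * u₂ = 0 := by
  obtain ⟨Z, ⟨P, hP⟩, ⟨e⟩⟩ := h
  let J : (X × X) →L[ℂ] X := Z.subtypeL.comp (e.symm : (X × X) →L[ℂ] Z)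
  let Q : X →L[ℂ] (X × X) := (e : Z →L[ℂ] (X × X)).comp P
  have hQJ : ∀ p, Q (J p) = p := fun p => by simp [Q, J, hP]
  refine ⟨J.comp (.inl ℂ X X), J.comp (.inr ℂ X X), (ContinuousLinearMap.fst ℂ X X).comp Q,
    (ContinuousLinearMap.snd ℂ X X).comp Q, ?_, ?_, ?_⟩ <;> ext x <;> simp [hQJ]

variable [CompleteSpace X]

/-- In a complementably minimal space the identity factors through every operator which is not
strictly singular. -/
lemma ComplementablyMinimal.exists_factorization (hX : ComplementablyMinimal X) {S : X →L[ℂ] X}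
    (hS : ¬ IsStrictlySingular S) : ∃ U V : X →L[ℂ] X, U * S * V = 1 := by
  simp only [IsStrictlySingular, not_forall, not_exists, not_and, not_lt] at hS
  obtain ⟨W, hW, hinf, c, hc, hlow⟩ := hS
  have : CompleteSpace W := hW.completeSpace_coe
  let SW : W →L[ℂ] X := S.domRestrict W
  have hanti : AntilipschitzWith (Real.toNNReal c⁻¹) SW := by
    refine AddMonoidHomClass.antilipschitz_of_bound _ fun x => ?_
    rw [Real.coe_toNNReal _ (by positivity), inv_mul_eq_div, le_div_iff₀ hc, mul_comm]
    exact hlow x x.2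
  have hcl : IsClosed (Set.range SW) := hanti.isClosed_range SW.uniformContinuous
  let E : W ≃L[ℂ] SW.range := SW.equivRange hanti.injective hcl
  have hE : ∀ w, (E w : X) = S w := fun w => rfl
  obtain ⟨Z, hZ, ⟨P, hP⟩, ⟨e⟩⟩ := hX SW.range (by rw [LinearMap.coe_range]; exact hcl)
    fun hfd => hinf (E.symm.toLinearEquiv.finiteDimensional)
  let V : X →L[ℂ] X := W.subtypeL.comp ((E.symm : SW.range →L[ℂ] W).comp
    ((Z.subtypeL.codRestrict SW.range fun z => hZ z.2).comp (e.symm : X →L[ℂ] Z)))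
  refine ⟨(e : Z →L[ℂ] X).comp P, V, ?_⟩
  ext x
  have h1 : S (V x) = (e.symm x : X) := by
    have := hE (E.symm ⟨(e.symm x : X), hZ (e.symm x).2⟩)
    rw [E.apply_symm_apply] at this
    exact this.symm
  change e (P (S (V x))) = x
  rw [h1, hP, e.apply_symm_apply]

end Complemented

/-! ### Homomorphisms onto `𝓑(Y)` -/

section Homomorphisms

variable {X : Type u} [NormedAddCommGroup X] [NormedSpace ℂ X]
  {Y : Type v} [NormedAddCommGroup Y] [NormedSpace ℂ Y]
  {ψ : (X →L[ℂ] X) →ₙₐ[ℂ] (Y →L[ℂ] Y)}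

lemma map_one_of_surjective (hψ : Function.Surjective ψ) : ψ 1 = 1 := by
  obtain ⟨T, hT⟩ := hψ 1
  calc ψ 1 = ψ T * ψ 1 := by rw [hT, one_mul]
    _ = 1 := by rw [← map_mul, mul_one, hT]

/-- A homomorphism with non-zero kernel kills all finite-rank operators. -/
lemma map_eq_zero_of_hasFiniteRange {T : X →L[ℂ] X} (hT : T ≠ 0) (hψT : ψ T = 0)
    {F : X →L[ℂ] X} (hF : (F : X →ₗ[ℂ] X).HasFiniteRange) : ψ F = 0 := by
  obtain ⟨x₀, hx₀⟩ : ∃ x, T x ≠ 0 := by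
    by_contra! h
    exact hT (ContinuousLinearMap.ext h)
  obtain ⟨g, -, hg⟩ := exists_dual_vector ℂ (T x₀) (norm_ne_zero_iff.2 hx₀)
  have hrank1 : ∀ (φ : X →L[ℂ] ℂ) (x : X), ψ (φ.smulRight x) = 0 := by
    intro φ x
    have hne : (‖T x₀‖ : ℂ) ≠ 0 := by exact_mod_cast (norm_ne_zero_iff.2 hx₀)
    have : φ.smulRight x =
        (g.smulRight ((‖T x₀‖ : ℂ)⁻¹ • x)) * T * (φ.smulRight x₀) := by
      ext y
      have hg' : g (T x₀) = (‖T x₀‖ : ℂ) := hg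
      simp [hg', smul_smul, mul_assoc, hne]
    rw [this, map_mul, map_mul, hψT, mul_zero, zero_mul]
  have hfin : FiniteDimensional ℂ F.range :=
    Module.Finite.iff_fg.2 (LinearMap.hasFiniteRange_iff_range.1 hF)
  obtain ⟨P, hP⟩ := Submodule.ClosedComplemented.of_finiteDimensional F.range
  let b := Module.finBasis ℂ F.range
  have hFsum : F = ∑ i, ((LinearMap.toContinuousLinearMap (b.coord i)).comp (P.comp F)).smulRight
      (b i : X) := by
    ext x
    have h1 : ((P (F x) : F.range) : X) = F x := congrArg Subtype.val (hP ⟨F x, x, rfl⟩)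
    have h2 := congrArg Subtype.val (b.sum_repr (P (F x)))
    rw [h1] at h2
    refine (h2.symm.trans (by rw [Submodule.coe_sum])).trans ?_
    simp [sum_apply]
  rw [hFsum, map_sum]
  exact Finset.sum_eq_zero fun i _ => hrank1 _ _

/-- A non-zero quotient of `𝓑(X)` of the form `𝓑(Y)` forces `Y` to be infinite-dimensional when
`X` contains a complemented copy of its square, since `𝓑(Y)` is not Dedekind-finite. -/
lemma HasComplementedSquare.not_finiteDimensional [Nontrivial Y] (hX : HasComplementedSquare X)
    (hψ : Function.Surjective ψ) : ¬ FiniteDimensional ℂ Y := by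
  intro hfd
  obtain ⟨u₁, u₂, v₁, v₂, h11, h22, h12⟩ := hX.exists_operators
  have h1 := map_one_of_surjective hψ
  have k11 : ψ v₁ * ψ u₁ = 1 := by rw [← map_mul, h11, h1]
  have k22 : ψ v₂ * ψ u₂ = 1 := by rw [← map_mul, h22, h1]
  have k12 : ψ v₁ * ψ u₂ = 0 := by rw [← map_mul, h12, map_zero]
  have kinv : ∀ y, ψ u₁ (ψ v₁ y) = y := by
    have : ((ψ v₁ : Y →L[ℂ] Y) : Y →ₗ[ℂ] Y) * (ψ u₁ : Y →L[ℂ] Y) = 1 := by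
      ext y; exact DFunLike.congr_fun k11 y
    have h := mul_eq_one_comm.1 this
    exact fun y => DFunLike.congr_fun h y
  obtain ⟨y, hy⟩ := exists_ne (0 : Y)
  have e1 : ψ v₂ (ψ u₂ y) = y := DFunLike.congr_fun k22 y
  have e2 : ψ v₁ (ψ u₂ y) = 0 := DFunLike.congr_fun k12 y
  have e3 := kinv (ψ u₂ y)
  rw [e2, map_zero] at e3
  rw [← e3, map_zero] at e1
  exact hy e1.symm

/-- A complementably minimal Banach space with a complemented copy of its square has the SHAI
property. -/
theorem hasSHAI_of_complementablyMinimal [CompleteSpace X] (hmin : ComplementablyMinimal X)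
    (hsq : HasComplementedSquare X) : HasSHAI.{u, v} X := by
  intro Y _ _ _ _ ψ hψ
  rw [injective_iff_map_eq_zero]
  intro T hψT
  by_contra hT
  have h1 := map_one_of_surjective hψ
  obtain ⟨y, hy⟩ := exists_ne (0 : Y)
  obtain ⟨g, -, hg⟩ := exists_dual_vector ℂ y (norm_ne_zero_iff.2 hy)
  have hne : (‖y‖ : ℂ) ≠ 0 := by exact_mod_cast (norm_ne_zero_iff.2 hy)
  -- `S` is a lift of a rank-one projection onto the line through `y`.
  obtain ⟨S, hS⟩ := hψ (((‖y‖ : ℂ)⁻¹ • g).smulRight y)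
  have hSy : ψ S y = y := by
    have hg' : g y = (‖y‖ : ℂ) := hg
    simp [hS, hg', hne]
  by_cases hsing : IsStrictlySingular S
  · obtain ⟨F, hF, w, hw⟩ := hsing.isIndexZero_one_sub
    have h2 : ψ (1 - S) = ψ w := by
      rw [hw, map_add, map_eq_zero_of_hasFiniteRange hT hψT hF, add_zero]
    have h3 : ψ (↑w⁻¹ : X →L[ℂ] X) * ψ (1 - S) = 1 := by
      rw [h2, ← map_mul, w.inv_mul, h1]
    have h4 : ψ (1 - S) y = 0 := by simp [map_sub, h1, hSy]
    have h5 := DFunLike.congr_fun h3 y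
    rw [mul_apply_eq_comp, h4, map_zero] at h5
    exact hy h5.symm
  · obtain ⟨U, V, hUV⟩ := hmin.exists_factorization hsing
    have h2 : ψ U * ψ S * ψ V = 1 := by rw [← map_mul, ← map_mul, hUV, h1]
    refine hsq.not_finiteDimensional hψ (Module.Finite.of_surjective
      (LinearMap.toSpanSingleton ℂ Y (ψ U y)) fun z => ?_)
    refine ⟨(‖y‖ : ℂ)⁻¹ * g (ψ V z), ?_⟩
    have h3 := DFunLike.congr_fun h2 z
    rw [hS] at h3
    simpa [smul_smul] using h3

end Homomorphisms

namespace Schlumprecht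

/-! ### Coordinate restrictions -/

section Restrict

lemma restrict_apply (E : Finset ℕ) (x : ℕ →₀ ℂ) (n : ℕ) :
    restrict E x n = if n ∈ E then x n else 0 := by
  simp [restrict, Finsupp.filter_apply]

lemma restrict_restrict (E F : Finset ℕ) (x : ℕ →₀ ℂ) :
    restrict E (restrict F x) = restrict (E ∩ F) x := by
  ext n
  simp only [restrict_apply, Finset.mem_inter]
  split_ifs <;> simp_all

lemma restrict_comm (E F : Finset ℕ) (x : ℕ →₀ ℂ) :
    restrict E (restrict F x) = restrict F (restrict E x) := by
  rw [restrict_restrict, restrict_restrict, Finset.inter_comm]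

lemma restrict_of_support_subset {E : Finset ℕ} {x : ℕ →₀ ℂ} (h : x.support ⊆ E) :
    restrict E x = x := by
  ext n
  rw [restrict_apply]
  split_ifs with hn
  · rfl
  · exact (Finsupp.notMem_support_iff.1 fun h' => hn (h h')).symm

lemma support_restrict (E : Finset ℕ) (x : ℕ →₀ ℂ) :
    (restrict E x).support = x.support ∩ E := by
  ext n
  simp [restrict_apply, and_comm]

/-- The coordinate restriction as a linear map. -/
noncomputable def restrictₗ (E : Finset ℕ) : (ℕ →₀ ℂ) →ₗ[ℂ] (ℕ →₀ ℂ) where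
  toFun := restrict E
  map_add' _ _ := Finsupp.filter_add
  map_smul' _ _ := Finsupp.filter_smul

lemma restrictₗ_apply (E : Finset ℕ) (x : ℕ →₀ ℂ) : restrictₗ E x = restrict E x := rfl

end Restrict

/-! ### Schlumprecht's norm -/

section Norm

lemma f_one : f 1 = 1 := by
  rw [f]; norm_num [Real.logb_self_eq_one]

lemma f_mono {l m : ℕ} (h : l ≤ m) : f l ≤ f m :=
  Real.logb_le_logb_of_le (by norm_num) (by positivity) (by exact_mod_cast Nat.succ_le_succ h)

lemma f_nonneg (l : ℕ) : 0 ≤ f l :=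
  Real.logb_nonneg (by norm_num) (by linarith [(Nat.cast_nonneg l : (0 : ℝ) ≤ l)])

lemma f_two_ge : 3 / 2 ≤ f 2 := by
  rw [f, Real.le_logb_iff_rpow_le (by norm_num) (by norm_num)]
  have h : ((2 : ℝ) ^ (3 / 2 : ℝ)) ^ 2 = 8 := by
    rw [← Real.rpow_natCast, ← Real.rpow_mul (by norm_num)]; norm_num
  have h0 : (0 : ℝ) ≤ 2 ^ (3 / 2 : ℝ) := by positivity
  push_cast
  nlinarith

lemma iterNorm_le (k : ℕ) (x : ℕ →₀ ℂ) : iterNorm k x ≤ schlumprechtNorm x :=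
  le_ciSup (bddAbove_iterNorm x) k

lemma schlumprechtNorm_le {x : ℕ →₀ ℂ} {c : ℝ} (h : ∀ k, iterNorm k x ≤ c) :
    schlumprechtNorm x ≤ c := ciSup_le h

lemma schlumprechtNorm_nonneg (x : ℕ →₀ ℂ) : 0 ≤ schlumprechtNorm x :=
  Real.iSup_nonneg fun k => iterNorm_nonneg k x

lemma schlumprechtNorm_le_l1 (x : ℕ →₀ ℂ) : schlumprechtNorm x ≤ l1 x :=
  schlumprechtNorm_le fun k => iterNorm_le_l1 k x

lemma norm_apply_le_schlumprechtNorm (x : ℕ →₀ ℂ) (n : ℕ) : ‖x n‖ ≤ schlumprechtNorm x :=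
  (le_ciSup (bddAbove_zero x) n).trans (iterNorm_le 0 x)

lemma schlumprechtNorm_add_le (x y : ℕ →₀ ℂ) :
    schlumprechtNorm (x + y) ≤ schlumprechtNorm x + schlumprechtNorm y :=
  schlumprechtNorm_le fun k => (iterNorm_add_le k x y).trans
    (add_le_add (iterNorm_le k x) (iterNorm_le k y))

lemma schlumprechtNorm_smul (c : ℂ) (x : ℕ →₀ ℂ) :
    schlumprechtNorm (c • x) = ‖c‖ * schlumprechtNorm x := c00_core.norm_smul c x

lemma schlumprechtNorm_zero : schlumprechtNorm 0 = 0 := by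
  simpa using schlumprechtNorm_smul 0 0

lemma schlumprechtNorm_sum_le {ι : Type*} (s : Finset ι) (x : ι → ℕ →₀ ℂ) :
    schlumprechtNorm (∑ i ∈ s, x i) ≤ ∑ i ∈ s, schlumprechtNorm (x i) := by
  classical
  induction s using Finset.induction_on with
  | empty => simp [schlumprechtNorm_zero]
  | insert a s ha ih =>
    rw [Finset.sum_insert ha, Finset.sum_insert ha]
    exact (schlumprechtNorm_add_le _ _).trans (by gcongr)

lemma le_iterNorm_succ (k : ℕ) (x : ℕ →₀ ℂ) (E : SuccessiveSets) :
    (∑ i, iterNorm k (restrict (E.set i) x)) / f E.card ≤ iterNorm (k + 1) x :=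
  le_ciSup (bddAbove_succ k x) E

lemma iterNorm_restrict_le (k : ℕ) (E : Finset ℕ) (x : ℕ →₀ ℂ) :
    iterNorm k (restrict E x) ≤ iterNorm k x := by
  induction k generalizing x with
  | zero =>
    refine ciSup_le fun n => le_trans ?_ (le_ciSup (bddAbove_zero x) n)
    rw [restrict_apply]
    split_ifs <;> simp
  | succ k ih =>
    refine ciSup_le fun F => le_trans ?_ (le_iterNorm_succ k x F)
    have := one_le_f F.one_le_card
    refine div_le_div_of_nonneg_right (Finset.sum_le_sum fun i _ => ?_) (by linarith)
    rw [restrict_comm]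
    exact ih _

lemma schlumprechtNorm_restrict_le (E : Finset ℕ) (x : ℕ →₀ ℂ) :
    schlumprechtNorm (restrict E x) ≤ schlumprechtNorm x :=
  schlumprechtNorm_le fun k => (iterNorm_restrict_le k E x).trans (iterNorm_le k x)

lemma iterNorm_mono (x : ℕ →₀ ℂ) : Monotone fun k => iterNorm k x := by
  refine monotone_nat_of_le_succ fun k => ?_
  let E : SuccessiveSets := ⟨1, le_rfl, fun _ => x.support, fun i j h => by
    exact absurd h (by simp [Subsingleton.elim i j])⟩
  have h := le_iterNorm_succ k x E
  have hcard : f E.card = 1 := f_one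
  rw [hcard, div_one] at h
  refine le_trans ?_ h
  have : iterNorm k (restrict (E.set 0) x) = iterNorm k x := by
    rw [restrict_of_support_subset (le_refl x.support)]
  rw [← this]
  exact Finset.single_le_sum (f := fun i => iterNorm k (restrict (E.set i) x))
    (fun i _ => iterNorm_nonneg _ _) (Finset.mem_univ 0)

lemma tendsto_iterNorm (x : ℕ →₀ ℂ) :
    Filter.Tendsto (fun k => iterNorm k x) Filter.atTop (𝓝 (schlumprechtNorm x)) :=
  tendsto_atTop_ciSup (iterNorm_mono x) (bddAbove_iterNorm x)

/-- The lower `f`-estimate, one half of the implicit equation satisfied by Schlumprecht's norm. -/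
lemma sum_schlumprechtNorm_restrict_le (E : SuccessiveSets) (x : ℕ →₀ ℂ) :
    ∑ i, schlumprechtNorm (restrict (E.set i) x) ≤ f E.card * schlumprechtNorm x := by
  have h1 := one_le_f E.one_le_card
  refine le_of_tendsto (tendsto_finsetSum _ fun i _ => tendsto_iterNorm (restrict (E.set i) x))
    (Filter.Eventually.of_forall fun k => ?_)
  have := (le_iterNorm_succ k x E).trans (iterNorm_le (k + 1) x)
  rw [div_le_iff₀ (by linarith)] at this
  linarith

/-- `A` lies to the left of `B`. -/
def Before (A B : Finset ℕ) : Prop := ∀ a ∈ A, ∀ b ∈ B, a < b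

lemma Before.mono {A B A' B' : Finset ℕ} (h : Before A B) (hA : A' ⊆ A) (hB : B' ⊆ B) :
    Before A' B' := fun a ha b hb => h a (hA ha) b (hB hb)

/-- The lower `f`-estimate for a list of successive sets. -/
lemma sum_schlumprechtNorm_list_le (L : List (Finset ℕ)) (hL : L.Pairwise Before) (x : ℕ →₀ ℂ) :
    (L.map fun E => schlumprechtNorm (restrict E x)).sum ≤ f L.length * schlumprechtNorm x := by
  rcases Nat.eq_zero_or_pos L.length with h0 | hpos
  · rw [List.length_eq_zero_iff.1 h0]
    simp [f]
  · have h := sum_schlumprechtNorm_restrict_le ⟨L.length, hpos, L.get,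
      fun i j hij => List.pairwise_iff_get.1 hL i j hij⟩ x
    refine le_of_eq_of_le ?_ h
    rw [← Fin.sum_univ_fun_getElem]
    rfl

/-- Domination: a sequence is dominated by any vector whose pieces on successive sets dominate its
coordinates. -/
lemma schlumprechtNorm_le_of_norm_apply_le {E : ℕ → Finset ℕ}
    (hE : ∀ i j, i < j → Before (E i) (E j)) {b x : ℕ →₀ ℂ}
    (h : ∀ i, ‖b i‖ ≤ schlumprechtNorm (restrict (E i) x)) :
    schlumprechtNorm b ≤ schlumprechtNorm x := by
  refine schlumprechtNorm_le fun k => ?_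
  induction k generalizing b x with
  | zero => exact ciSup_le fun n => (h n).trans (schlumprechtNorm_restrict_le _ _)
  | succ k ih =>
    refine ciSup_le fun F => ?_
    have h1 := one_le_f F.one_le_card
    rw [div_le_iff₀ (by linarith), mul_comm]
    let G : SuccessiveSets := ⟨F.card, F.one_le_card, fun j => (F.set j).biUnion E, by
      intro i j hij a ha b hb
      obtain ⟨m, hm, ham⟩ := Finset.mem_biUnion.1 ha
      obtain ⟨n, hn, hbn⟩ := Finset.mem_biUnion.1 hb
      exact hE m n (F.lt_of_lt i j hij m hm n hn) a ham b hbn⟩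
    refine (Finset.sum_le_sum fun j _ => ?_).trans (sum_schlumprechtNorm_restrict_le G x)
    refine ih fun i => ?_
    rw [restrict_apply, restrict_restrict]
    split_ifs with hi
    · have : E i ∩ G.set j = E i :=
        Finset.inter_eq_left.2 (Finset.subset_biUnion_of_mem E hi)
      rw [this]
      exact h i
    · rw [norm_zero]
      exact schlumprechtNorm_nonneg _

end Norm

/-! ### Weighted families of successive sets -/

section Families

/-- A weighted family of successive sets of order `Y`: weights in `[0, 1]`, with at most
`2 ^ (20 √(Y / u))` of them above the level `u`. This growth is slow enough for weighted sums over
the family to be bounded by the norm (`IsFamily.value_le`), and fast enough to be preserved by the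
operation `isFamily_of_blocks`. -/
structure IsFamily (Y : ℝ) (L : List (Finset ℕ × ℝ)) : Prop where
  pairwise : L.Pairwise fun p q => Before p.1 q.1
  weight_mem : ∀ p ∈ L, 0 ≤ p.2 ∧ p.2 ≤ 1
  count_le : ∀ u : ℝ, 0 < u → u ≤ 1 → (L.countP fun p => u ≤ p.2 : ℝ) ≤ 2 ^ (20 * √(Y / u))

/-- The weighted sum `∑ ω ‖E x‖` over a list of pairs `(E, ω)`. -/
noncomputable def value (L : List (Finset ℕ × ℝ)) (x : ℕ →₀ ℂ) : ℝ :=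
  (L.map fun p => p.2 * schlumprechtNorm (restrict p.1 x)).sum

/-- The superlevel sum `∑ {v p | ω p ≥ u}` of a weighted list. -/
noncomputable def levelSum {α : Type*} (L : List α) (ω v : α → ℝ) (u : ℝ) : ℝ :=
  (L.map fun p => if u ≤ ω p then v p else 0).sum

lemma intervalIntegrable_ite_le (w c : ℝ) :
    IntervalIntegrable (fun u : ℝ => if u ≤ w then c else 0) MeasureTheory.volume 0 1 := by
  have : (fun u : ℝ => if u ≤ w then c else 0) = (Set.Iic w).indicator fun _ => c := by
    ext u; simp [Set.indicator_apply]
  rw [this, intervalIntegrable_iff_integrableOn_Ioc_of_le zero_le_one]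
  exact MeasureTheory.IntegrableOn.indicator
    (MeasureTheory.integrableOn_const measure_Ioc_lt_top.ne) measurableSet_Iic

lemma integral_ite_le {w : ℝ} (hw0 : 0 ≤ w) (hw1 : w ≤ 1) (c : ℝ) :
    ∫ u in (0 : ℝ)..1, (if u ≤ w then c else 0) = w * c := by
  rw [← intervalIntegral.integral_add_adjacent_intervals (b := w)]
  · have h1 : ∫ u in (0 : ℝ)..w, (if u ≤ w then c else 0) = ∫ u in (0 : ℝ)..w, c :=
      intervalIntegral.integral_congr_ae (Filter.Eventually.of_forall fun u hu => by
        rw [Set.uIoc_of_le hw0] at hu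
        exact if_pos hu.2)
    have h2 : ∫ u in w..1, (if u ≤ w then c else 0) = ∫ u in w..1, (0 : ℝ) :=
      intervalIntegral.integral_congr_ae (Filter.Eventually.of_forall fun u hu => by
        rw [Set.uIoc_of_le hw1] at hu
        exact if_neg (not_le.2 hu.1))
    rw [h1, h2]
    simp
  · exact (intervalIntegrable_ite_le w c).mono_set
      (Set.uIcc_subset_uIcc_left (by rw [Set.uIcc_of_le zero_le_one]; exact ⟨hw0, hw1⟩))
  · exact (intervalIntegrable_ite_le w c).mono_set
      (Set.uIcc_subset_uIcc_right (by rw [Set.uIcc_of_le zero_le_one]; exact ⟨hw0, hw1⟩))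

lemma intervalIntegrable_levelSum {α : Type*} (L : List α) (ω v : α → ℝ) :
    IntervalIntegrable (levelSum L ω v) MeasureTheory.volume 0 1 := by
  induction L with
  | nil => exact intervalIntegrable_const (c := 0)
  | cons p L ih => exact (intervalIntegrable_ite_le (ω p) (v p)).add ih

/-- The layer-cake formula for a finite weighted sum. -/
lemma sum_weight_mul_eq_integral {α : Type*} (L : List α) (ω v : α → ℝ)
    (hω : ∀ p ∈ L, 0 ≤ ω p ∧ ω p ≤ 1) :
    (L.map fun p => ω p * v p).sum = ∫ u in (0 : ℝ)..1, levelSum L ω v u := by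
  induction L with
  | nil => simp [levelSum]
  | cons p L ih =>
    have h1 : ∀ u, levelSum (p :: L) ω v u =
        (if u ≤ ω p then v p else 0) + levelSum L ω v u := fun u => by simp [levelSum]
    simp_rw [h1]
    rw [intervalIntegral.integral_add (intervalIntegrable_ite_le _ _)
      (intervalIntegrable_levelSum L ω v), integral_ite_le (hω p List.mem_cons_self).1
      (hω p List.mem_cons_self).2, ← ih fun q hq => hω q (List.mem_cons_of_mem _ hq)]
    simp

/-- A weighted sum over successive sets is controlled by the growth of the number
of sets with large weight: apply the layer-cake formula and the lower estimate
`f(m) ‖x‖ ≥ ∑ ‖E x‖` over the `m` sets with weight at least `u`. -/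
lemma value_le_of_count {L : List (Finset ℕ × ℝ)} (hL : L.Pairwise fun p q => Before p.1 q.1)
    (hω : ∀ p ∈ L, 0 ≤ p.2 ∧ p.2 ≤ 1) {A B : ℝ}
    (hcount : ∀ u : ℝ, 0 < u → u ≤ 1 →
      f (L.countP fun p => u ≤ p.2) ≤ A + B * u ^ (-(1 / 2) : ℝ)) (x : ℕ →₀ ℂ) :
    value L x ≤ (A + 2 * B) * schlumprechtNorm x := by
  have hint : IntervalIntegrable (fun u : ℝ => u ^ (-(1 / 2) : ℝ)) MeasureTheory.volume 0 1 :=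
    intervalIntegral.intervalIntegrable_rpow' (by norm_num)
  have hintegral : ∫ u in (0 : ℝ)..1, (A + B * u ^ (-(1 / 2) : ℝ)) * schlumprechtNorm x =
      (A + 2 * B) * schlumprechtNorm x := by
    rw [intervalIntegral.integral_mul_const, intervalIntegral.integral_add
      intervalIntegrable_const (hint.const_mul B), intervalIntegral.integral_const_mul,
      integral_rpow (Or.inl (by norm_num))]
    congr 1
    norm_num
    ring
  rw [value, sum_weight_mul_eq_integral L Prod.snd _ hω, ← hintegral]
  refine intervalIntegral.integral_mono_on_of_le_Ioo zero_le_one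
    (intervalIntegrable_levelSum _ _ _)
    ((intervalIntegrable_const.add (hint.const_mul B)).mul_const _) fun u hu => ?_
  have hlevel : levelSum L Prod.snd (fun p => schlumprechtNorm (restrict p.1 x)) u =
      (((L.filter fun p => u ≤ p.2).map Prod.fst).map
        fun E => schlumprechtNorm (restrict E x)).sum := by
    rw [levelSum, List.map_map]
    clear hL hω hcount
    induction L with
    | nil => simp
    | cons p L ih => by_cases hp : u ≤ p.2 <;> simp [hp, ih]
  rw [hlevel]
  refine (sum_schlumprechtNorm_list_le _ ?_ x).trans ?_
  · exact List.pairwise_map.2 (hL.filter _)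
  · rw [List.length_map, ← List.countP_eq_length_filter]
    exact mul_le_mul_of_nonneg_right (hcount u hu.1 hu.2.le) (schlumprechtNorm_nonneg x)

lemma f_eq_of_le_two_rpow {m l : ℕ} {s : ℝ} (h : (m : ℝ) + 1 ≤ (l + 1) * 2 ^ s) :
    f m ≤ f l + s := by
  have h2 : f l + s = Real.logb 2 (((l : ℝ) + 1) * 2 ^ s) := by
    rw [f, Real.logb_mul (by positivity) (by positivity),
      Real.logb_rpow (by norm_num) (by norm_num)]
  rw [h2, f]
  exact Real.logb_le_logb_of_le (by norm_num) (by positivity) h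

lemma two_rpow_f (l : ℕ) : (2 : ℝ) ^ f l = l + 1 :=
  Real.rpow_logb (by norm_num) (by norm_num) (by positivity)

lemma one_le_two_rpow_sqrt (t : ℝ) : (1 : ℝ) ≤ 2 ^ (20 * √t) :=
  Real.one_le_rpow (by norm_num) (by positivity)

lemma count_le_of_le {n : ℝ} {l : ℕ} {t : ℝ} (hn : n ≤ l * (2 + 2 ^ (20 * √t))) :
    n + 1 ≤ (l + 1) * 2 ^ (2 + 20 * √t) := by
  have h1 := one_le_two_rpow_sqrt t
  rw [Real.rpow_add (by norm_num)]
  have hl : (0 : ℝ) ≤ l := Nat.cast_nonneg l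
  norm_num
  nlinarith

/-- The weighted sum over `l` families of order `Y` and `2 l` additional sets is bounded by
`f l + O(√Y)` times the norm. -/
lemma value_le_of_blocks {Y : ℝ} (hY : 0 ≤ Y) {l : ℕ} {U : List (Finset ℕ × ℝ)}
    (hU : U.Pairwise fun p q => Before p.1 q.1) (hω : ∀ p ∈ U, 0 ≤ p.2 ∧ p.2 ≤ 1)
    (hcount : ∀ u : ℝ, 0 < u → u ≤ 1 →
      (U.countP fun p => u ≤ p.2 : ℝ) ≤ l * (2 + 2 ^ (20 * √(Y / u)))) (x : ℕ →₀ ℂ) :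
    value U x ≤ (f l + 2 + 40 * √Y) * schlumprechtNorm x := by
  have h := value_le_of_count hU hω (A := f l + 2) (B := 20 * √Y) (fun u hu0 hu1 => ?_) x
  · convert h using 2; ring
  · refine (f_eq_of_le_two_rpow (count_le_of_le (hcount u hu0 hu1))).trans (le_of_eq ?_)
    rw [Real.sqrt_div hY, Real.rpow_neg hu0.le, ← Real.sqrt_eq_rpow]
    ring

/-- Scaling the weights by `1 / f l` turns `l ≥ 2` families of order `Y ≥ f l`, together with
`2 l` additional sets, into one family of order `Y`. -/
lemma isFamily_of_blocks {Y : ℝ} {l : ℕ} (hl : 2 ≤ l) (hlY : f l ≤ Y) {U : List (Finset ℕ × ℝ)}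
    (hU : U.Pairwise fun p q => Before p.1 q.1) (hω : ∀ p ∈ U, 0 ≤ p.2 ∧ p.2 ≤ 1)
    (hcount : ∀ u : ℝ, 0 < u → u ≤ 1 →
      (U.countP fun p => u ≤ p.2 : ℝ) ≤ l * (2 + 2 ^ (20 * √(Y / u)))) :
    IsFamily Y (U.map fun p => (p.1, p.2 / f l)) := by
  have hx : 3 / 2 ≤ f l := f_two_ge.trans (f_mono hl)
  have hx0 : 0 < f l := by linarith
  refine ⟨List.pairwise_map.2 hU, ?_, ?_⟩
  · intro p hp
    obtain ⟨q, hq, rfl⟩ := List.mem_map.1 hp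
    refine ⟨div_nonneg (hω q hq).1 hx0.le, ?_⟩
    rw [div_le_one hx0]
    linarith [(hω q hq).2]
  · intro u hu0 hu1
    rw [List.countP_map]
    by_cases hux : u * f l ≤ 1
    · have hc := hcount (u * f l) (by positivity) hux
      have heq : (U.countP ((fun p => decide (u ≤ p.2)) ∘ fun p => (p.1, p.2 / f l))) =
          U.countP fun p => u * f l ≤ p.2 :=
        List.countP_congr fun p _ => by simp [le_div_iff₀ hx0]
      rw [heq]
      have h1 := count_le_of_le hc
      rw [show ((l : ℝ) + 1) = 2 ^ f l from (two_rpow_f l).symm,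
        ← Real.rpow_add (by norm_num)] at h1
      refine le_trans (by linarith) (h1.trans (Real.rpow_le_rpow_of_exponent_le (by norm_num) ?_))
      -- With `s = √(f l)` and `r = √(Y / (u f l)) ≥ s` the claim is `s² + 2 + 20 r ≤ 20 r s`.
      set s := √(f l) with hs
      set r := √(Y / (u * f l)) with hr
      have hs2 : s ^ 2 = f l := Real.sq_sqrt hx0.le
      have hs1 : 6 / 5 ≤ s := by
        rw [hs]; exact Real.le_sqrt_of_sq_le (by linarith)
      have hrs : √(Y / u) = r * s := by
        rw [hr, hs, ← Real.sqrt_mul' _ hx0.le]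
        congr 1
        field_simp
      have hr1 : s ≤ r := by
        rw [hs, hr]
        refine Real.sqrt_le_sqrt ?_
        rw [le_div_iff₀ (by positivity)]
        nlinarith
      rw [hrs, ← hs2]
      nlinarith
    · have hzero : U.countP ((fun p => decide (u ≤ p.2)) ∘ fun p => (p.1, p.2 / f l)) = 0 := by
        rw [List.countP_eq_zero]
        intro p hp
        have := (hω p hp).2
        simp only [Function.comp_apply, decide_eq_true_eq, not_le]
        rw [div_lt_iff₀ hx0]
        push Not at hux
        linarith
      rw [hzero]
      simpa using (by positivity : (0 : ℝ) ≤ 2 ^ (20 * √(Y / u)))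

lemma isFamily_singleton {Y : ℝ} (E : Finset ℕ) : IsFamily Y [(E, 1)] := by
  refine ⟨by simp, by simp, fun u _ hu1 => ?_⟩
  simpa [List.countP_cons, hu1] using one_le_two_rpow_sqrt (Y / u)

lemma isFamily_nil {Y : ℝ} : IsFamily Y [] :=
  ⟨by simp, by simp, fun u _ _ => by simpa using (by positivity : (0 : ℝ) ≤ 2 ^ (20 * √(Y / u)))⟩

lemma IsFamily.value_le {Y : ℝ} (hY : 0 ≤ Y) {L : List (Finset ℕ × ℝ)} (hL : IsFamily Y L)
    (x : ℕ →₀ ℂ) : value L x ≤ (3 + 40 * √Y) * schlumprechtNorm x := by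
  have h := value_le_of_blocks hY hL.pairwise hL.weight_mem (l := 1)
    (fun u h0 h1 => (hL.count_le u h0 h1).trans (by simp)) x
  rw [f_one] at h
  linarith

/-- `l` families, each one preceded by one additional set and followed by another one. -/
def blocks {l : ℕ} (D D' : Fin l → Finset ℕ) (L : Fin l → List (Finset ℕ × ℝ)) :
    List (Finset ℕ × ℝ) :=
  (List.finRange l).flatMap fun j => (D j, 1) :: (L j ++ [(D' j, 1)])

lemma value_blocks {l : ℕ} (D D' : Fin l → Finset ℕ) (L : Fin l → List (Finset ℕ × ℝ))
    (x : ℕ →₀ ℂ) : value (blocks D D' L) x = ∑ j, (schlumprechtNorm (restrict (D j) x) +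
      value (L j) x + schlumprechtNorm (restrict (D' j) x)) := by
  rw [value, blocks, List.map_flatMap, List.flatMap, List.sum_flatten, List.map_map,
    Fin.sum_univ_def]
  congr 1
  refine List.map_congr_left fun j _ => ?_
  simp [value, add_assoc]

lemma value_scale (U : List (Finset ℕ × ℝ)) (c : ℝ) (x : ℕ →₀ ℂ) :
    value (U.map fun p => (p.1, p.2 / c)) x = value U x / c := by
  rw [value, value, List.map_map, div_eq_mul_inv, ← List.sum_map_mul_right]
  congr 1
  refine List.map_congr_left fun p _ => ?_
  simp only [Function.comp_apply]
  ring

lemma weight_mem_blocks {l : ℕ} {D D' : Fin l → Finset ℕ} {L : Fin l → List (Finset ℕ × ℝ)}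
    {Y : ℝ} (hL : ∀ j, IsFamily Y (L j)) : ∀ p ∈ blocks D D' L, 0 ≤ p.2 ∧ p.2 ≤ 1 := by
  intro p hp
  obtain ⟨j, -, hj⟩ := List.mem_flatMap.1 hp
  simp only [List.mem_cons, List.mem_append, List.not_mem_nil, or_false] at hj
  rcases hj with rfl | hj | rfl
  · norm_num
  · exact (hL j).weight_mem p hj
  · norm_num

lemma count_blocks_le {l : ℕ} {D D' : Fin l → Finset ℕ} {L : Fin l → List (Finset ℕ × ℝ)}
    {Y : ℝ} (hL : ∀ j, IsFamily Y (L j)) (u : ℝ) (hu0 : 0 < u) (hu1 : u ≤ 1) :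
    ((blocks D D' L).countP fun p => u ≤ p.2 : ℝ) ≤ l * (2 + 2 ^ (20 * √(Y / u))) := by
  rw [blocks, List.countP_flatMap, ← Fin.sum_univ_def]
  push_cast
  refine (Finset.sum_le_card_nsmul _ _ (2 + 2 ^ (20 * √(Y / u))) fun j _ => ?_).trans
    (by simp [mul_add])
  have := (hL j).count_le u hu0 hu1
  simp only [Function.comp_apply, List.countP_cons, List.countP_append, List.countP_nil, hu1,
    decide_true, if_true]
  push_cast
  linarith

/-- Blocks located in successive zones `C j` form a list of successive sets. -/
lemma pairwise_blocks {l : ℕ} {D D' C : Fin l → Finset ℕ} {L : Fin l → List (Finset ℕ × ℝ)}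
    {Y : ℝ} (hL : ∀ j, IsFamily Y (L j)) (hC : ∀ i j, i < j → Before (C i) (C j))
    (hDC : ∀ j, D j ⊆ C j) (hDC' : ∀ j, D' j ⊆ C j) (hLC : ∀ j, ∀ p ∈ L j, p.1 ⊆ C j)
    (hDL : ∀ j, ∀ p ∈ L j, Before (D j) p.1) (hLD : ∀ j, ∀ p ∈ L j, Before p.1 (D' j))
    (hDD : ∀ j, Before (D j) (D' j)) :
    (blocks D D' L).Pairwise fun p q => Before p.1 q.1 := by
  have hsub : ∀ j, ∀ p ∈ (D j, (1 : ℝ)) :: (L j ++ [(D' j, 1)]), p.1 ⊆ C j := by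
    intro j p hp
    simp only [List.mem_cons, List.mem_append, List.not_mem_nil, or_false] at hp
    rcases hp with rfl | hp | rfl
    · exact hDC j
    · exact hLC j p hp
    · exact hDC' j
  rw [blocks, List.pairwise_flatMap]
  refine ⟨fun j _ => ?_, (List.pairwise_lt_finRange l).imp fun {i j} hij p hp q hq =>
    (hC i j hij).mono (hsub i p hp) (hsub j q hq)⟩
  rw [List.pairwise_cons, List.pairwise_append]
  refine ⟨?_, (hL j).pairwise, by simp, ?_⟩
  · intro p hp
    simp only [List.mem_append, List.mem_cons, List.not_mem_nil, or_false] at hp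
    rcases hp with hp | rfl
    · exact hDL j p hp
    · exact hDD j
  · intro p hp q hq
    simp only [List.mem_cons, List.not_mem_nil, or_false] at hq
    subst hq
    exact hLD j p hp

end Families

/-! ### The upper estimate for rapidly increasing averages -/

section UpperEstimate

/-- A block sequence of vectors of norm at most one which behave like averages of rapidly
increasing lengths: `y i` has bounded `ℓ₁`-sums over `n i` successive sets, and `n q` is large
compared with the `ℓ₁`-norms of all predecessors of `y q`. -/
structure IsRapid (y : ℕ → ℕ →₀ ℂ) (n : ℕ → ℕ) : Prop where
  before : ∀ i j, i < j → Before (y i).support (y j).support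
  norm_le : ∀ i, schlumprechtNorm (y i) ≤ 1
  strictMono : StrictMono n
  sum_le : ∀ i, ∀ E : SuccessiveSets, E.card ≤ n i →
    ∑ j, schlumprechtNorm (restrict (E.set j) (y i)) ≤ 4
  l1_le : ∀ q, ∑ i ∈ Finset.range q, l1 (y i) ≤ f (n q)

/-- The vector `∑ aᵢ yᵢ`. -/
noncomputable def comb (y : ℕ → ℕ →₀ ℂ) (a : ℕ →₀ ℂ) : ℕ →₀ ℂ := Finsupp.linearCombination ℂ y a

lemma comb_eq_sum (y : ℕ → ℕ →₀ ℂ) {a : ℕ →₀ ℂ} {s : Finset ℕ} (h : a.support ⊆ s) :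
    comb y a = ∑ i ∈ s, a i • y i := by
  rw [comb, Finsupp.linearCombination_apply]
  exact Finsupp.sum_of_support_subset a h _ fun i _ => zero_smul _ _

lemma restrict_sum (E : Finset ℕ) {ι : Type*} (s : Finset ι) (x : ι → ℕ →₀ ℂ) :
    restrict E (∑ i ∈ s, x i) = ∑ i ∈ s, restrict E (x i) := map_sum (restrictₗ E) x s

lemma restrict_smul (E : Finset ℕ) (c : ℂ) (x : ℕ →₀ ℂ) :
    restrict E (c • x) = c • restrict E x := map_smul (restrictₗ E) c x

lemma restrict_restrict_of_subset {E F : Finset ℕ} (h : E ⊆ F) (x : ℕ →₀ ℂ) :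
    restrict E (restrict F x) = restrict E x := by
  rw [restrict_restrict, Finset.inter_eq_left.2 h]

lemma value_restrict {L : List (Finset ℕ × ℝ)} {F : Finset ℕ} (h : ∀ p ∈ L, p.1 ⊆ F)
    (x : ℕ →₀ ℂ) : value L (restrict F x) = value L x := by
  rw [value, value]
  congr 1
  exact List.map_congr_left fun p hp => by rw [restrict_restrict_of_subset (h p hp)]

lemma norm_apply_le_of_mem {E : Finset ℕ} {i : ℕ} (hi : i ∈ E) (x : ℕ →₀ ℂ) :
    ‖x i‖ ≤ schlumprechtNorm (restrict E x) := by
  have := norm_apply_le_schlumprechtNorm (restrict E x) i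
  rwa [restrict_apply, if_pos hi] at this

lemma sum_norm_le_of_subsingleton {E : Finset ℕ} (h : ∀ i ∈ E, ∀ j ∈ E, i = j) (x : ℕ →₀ ℂ) :
    ∑ i ∈ E, ‖x i‖ ≤ schlumprechtNorm (restrict E x) := by
  rcases E.eq_empty_or_nonempty with rfl | ⟨i, hi⟩
  · simpa using schlumprechtNorm_nonneg _
  · have hE : E = {i} := Finset.eq_singleton_iff_unique_mem.2 ⟨hi, fun j hj => h j hj i hi⟩
    calc ∑ i ∈ E, ‖x i‖ = ‖x i‖ := by rw [hE, Finset.sum_singleton]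
      _ ≤ _ := norm_apply_le_of_mem hi x

/-- The constant with which families of order `Y` dominate the norm. -/
noncomputable def upperConst (Y : ℝ) : ℝ := 1 + 328 / √Y

lemma one_le_upperConst (Y : ℝ) : 1 ≤ upperConst Y := by
  rw [upperConst]
  have : 0 ≤ 328 / √Y := by positivity
  linarith

lemma upperConst_anti {x Y : ℝ} (hY : 0 < Y) (h : Y ≤ x) : upperConst x ≤ upperConst Y := by
  rw [upperConst, upperConst]
  have := Real.sqrt_pos.2 hY
  gcongr

/-- The inequality which determines `upperConst` and the threshold `26896 = 164²`: with `s = √x`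
it reads `(1 + 164 / s) (1 + 80 / s + 2 / s ²) ≤ 1 + 328 / s`. -/
lemma upperConst_four_mul_le {x : ℝ} (hx : 26896 ≤ x) :
    upperConst (4 * x) * (x + 2 + 40 * √(4 * x)) / x ≤ upperConst x := by
  have h4 : √(4 * x) = 2 * √x := by
    rw [Real.sqrt_mul (by norm_num), show (4 : ℝ) = 2 ^ 2 by norm_num,
      Real.sqrt_sq (by norm_num)]
  rw [upperConst, upperConst, h4]
  have hs : 164 ≤ √x := Real.le_sqrt_of_sq_le (by norm_num; linarith)
  have hsq : x = √x ^ 2 := (Real.sq_sqrt (by linarith)).symm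
  set s := √x
  have h0 : 0 < s := by linarith
  rw [hsq]
  have h1 : (1 + 328 / (2 * s)) * (s ^ 2 + 2 + 40 * (2 * s)) / s ^ 2 =
      ((s + 164) * (s ^ 2 + 2 + 80 * s)) / (s * s ^ 2) := by
    field_simp
    ring
  have h2 : 1 + 328 / s = ((s + 328) * s ^ 2) / (s * s ^ 2) := by
    field_simp
  rw [h1, h2]
  refine div_le_div_of_nonneg_right ?_ (by positivity)
  nlinarith

/-- The vectors with `n i < l` contribute little to an average over `l` successive sets: all but
the last of them have small `ℓ₁`-norm compared with `f l`. -/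
lemma IsRapid.sum_sum_le {y : ℕ → ℕ →₀ ℂ} {n : ℕ → ℕ} (hy : IsRapid y n) (E : SuccessiveSets)
    {Q : ℕ} (hQ : ∀ i < Q, n i < E.card) :
    ∑ i ∈ Finset.range Q, ∑ j, schlumprechtNorm (restrict (E.set j) (y i)) ≤ 2 * f E.card := by
  cases Q with
  | zero => simpa using f_nonneg _
  | succ q =>
    rw [Finset.sum_range_succ, two_mul]
    refine add_le_add ?_ ?_
    · calc ∑ i ∈ Finset.range q, ∑ j, schlumprechtNorm (restrict (E.set j) (y i))
          ≤ ∑ i ∈ Finset.range q, l1 (y i) := Finset.sum_le_sum fun i _ =>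
            (Finset.sum_le_sum fun j _ => schlumprechtNorm_le_l1 _).trans (sum_l1_restrict_le E _)
        _ ≤ f (n q) := hy.l1_le q
        _ ≤ f E.card := f_mono (hQ q (Nat.lt_succ_self q)).le
    · refine (sum_schlumprechtNorm_restrict_le E (y q)).trans ?_
      exact mul_le_of_le_one_right (f_nonneg _) (hy.norm_le q)

/-- The set `E j` meets the support of `y i`. -/
def Meets (y : ℕ → ℕ →₀ ℂ) (E : SuccessiveSets) (i : ℕ) (j : Fin E.card) : Prop :=
  ∃ b ∈ E.set j, b ∈ (y i).support

lemma le_of_meets {y : ℕ → ℕ →₀ ℂ}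
    (hy : ∀ i j, i < j → Before (y i).support (y j).support) {E : SuccessiveSets}
    {i i' : ℕ} {j j' : Fin E.card} (hi : i < i') (h : Meets y E i j) (h' : Meets y E i' j') :
    j ≤ j' := by
  obtain ⟨b, hb, hbi⟩ := h
  obtain ⟨b', hb', hbi'⟩ := h'
  by_contra! hlt
  exact lt_asymm (hy i i' hi b hbi b' hbi') (E.lt_of_lt j' j hlt b' hb' b hb)

lemma restrict_eq_zero_of_not_meets {y : ℕ → ℕ →₀ ℂ} {E : SuccessiveSets} {i : ℕ}
    {j : Fin E.card} (h : ¬ Meets y E i j) : restrict (E.set j) (y i) = 0 := by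
  ext b
  rw [restrict_apply]
  split_ifs with hb
  · by_contra hne
    exact h ⟨b, hb, Finsupp.mem_support_iff.2 hne⟩
  · rfl

open Classical in
/-- The indices from `H` of the vectors met by `E j` and by no other set. -/
noncomputable def innerIndices (y : ℕ → ℕ →₀ ℂ) (E : SuccessiveSets) (H : Finset ℕ)
    (j : Fin E.card) : Finset ℕ :=
  H.filter fun i => Meets y E i j ∧ ∀ j', Meets y E i j' → j' = j

open Classical in
/-- The indices from `H` of the vectors met by several sets, the first one being `E j`. -/
noncomputable def boundaryIndices (y : ℕ → ℕ →₀ ℂ) (E : SuccessiveSets) (H : Finset ℕ)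
    (j : Fin E.card) : Finset ℕ :=
  H.filter fun i => Meets y E i j ∧ (∀ j', Meets y E i j' → j ≤ j') ∧ ∃ j', j < j' ∧ Meets y E i j'

section Zones

variable {y : ℕ → ℕ →₀ ℂ} {n : ℕ → ℕ} {E : SuccessiveSets} {H : Finset ℕ}

lemma inner_subset (j : Fin E.card) : innerIndices y E H j ⊆ H := by
  classical exact Finset.filter_subset _ _

lemma boundary_subset (j : Fin E.card) : boundaryIndices y E H j ⊆ H := by
  classical exact Finset.filter_subset _ _

lemma first_of_mem {j : Fin E.card} {i : ℕ}
    (hi : i ∈ innerIndices y E H j ∪ boundaryIndices y E H j) :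
    Meets y E i j ∧ ∀ j', Meets y E i j' → j ≤ j' := by
  classical
  rcases Finset.mem_union.1 hi with h | h
  · obtain ⟨-, h1, h2⟩ := Finset.mem_filter.1 h
    exact ⟨h1, fun j' h' => (h2 j' h').ge⟩
  · obtain ⟨-, h1, h2, -⟩ := Finset.mem_filter.1 h
    exact ⟨h1, h2⟩

/-- The vectors whose first set is `E j` precede those whose first set is `E j'`, if `j < j'`. -/
lemma IsRapid.before_zones (hy : IsRapid y n) {j j' : Fin E.card} (hj : j < j') :
    Before (innerIndices y E H j ∪ boundaryIndices y E H j)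
      (innerIndices y E H j' ∪ boundaryIndices y E H j') := by
  intro i hi i' hi'
  obtain ⟨h1, h2⟩ := first_of_mem hi
  obtain ⟨h1', h2'⟩ := first_of_mem hi'
  by_contra! hle
  rcases hle.eq_or_lt with rfl | hlt
  · exact absurd (h2' j h1) (not_le.2 hj)
  · exact absurd (le_of_meets hy.before hlt h1' h1) (not_le.2 hj)

lemma IsRapid.before_inner_boundary (hy : IsRapid y n) (j : Fin E.card) :
    Before (innerIndices y E H j) (boundaryIndices y E H j) := by
  classical
  intro i hi i' hi'
  obtain ⟨-, h1, h2⟩ := Finset.mem_filter.1 hi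
  obtain ⟨-, -, -, j', hj', h3⟩ := Finset.mem_filter.1 hi'
  by_contra! hle
  rcases hle.eq_or_lt with rfl | hlt
  · exact hj'.ne' (h2 j' h3)
  · exact absurd (le_of_meets hy.before hlt h3 h1) (not_le.2 hj')

/-- At most one vector starts at `E j` and extends further. -/
lemma IsRapid.eq_of_mem_boundary (hy : IsRapid y n) (j : Fin E.card) :
    ∀ i ∈ boundaryIndices y E H j, ∀ i' ∈ boundaryIndices y E H j, i = i' := by
  classical
  have key : ∀ i ∈ boundaryIndices y E H j, ∀ i' ∈ boundaryIndices y E H j, ¬ i < i' := by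
    intro i hi i' hi' hlt
    obtain ⟨-, -, -, j', hj', h3⟩ := Finset.mem_filter.1 hi
    obtain ⟨-, h1, -⟩ := Finset.mem_filter.1 hi'
    exact absurd (le_of_meets hy.before hlt h3 h1) (not_le.2 hj')
  intro i hi i' hi'
  exact le_antisymm (not_lt.1 (key i' hi' i hi)) (not_lt.1 (key i hi i' hi'))

open Classical in
lemma pairwiseDisjoint_boundary :
    Set.PairwiseDisjoint (↑(Finset.univ : Finset (Fin E.card))) (boundaryIndices y E H) := by
  intro j _ j' _ hne
  refine Finset.disjoint_left.2 fun i hi hi' => hne ?_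
  obtain ⟨-, h1, h2, -⟩ := Finset.mem_filter.1 hi
  obtain ⟨-, h1', h2', -⟩ := Finset.mem_filter.1 hi'
  exact le_antisymm (h2 j' h1') (h2' j h1)

open Classical in
lemma not_meets_of_notMem {i : ℕ} (hi : i ∈ H) {j : Fin E.card} (h1 : i ∉ innerIndices y E H j)
    (h2 : i ∉ Finset.univ.biUnion (boundaryIndices y E H)) : ¬ Meets y E i j := by
  intro hM
  obtain ⟨j₁, hj₁, hmin⟩ := wellFounded_lt.has_min {j | Meets y E i j} ⟨j, hM⟩
  have hmin' : ∀ j', Meets y E i j' → j₁ ≤ j' := fun j' h' => not_lt.1 (hmin j' h')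
  have hnone : ∀ j', Meets y E i j' → j' = j₁ := by
    intro j' h'
    by_contra hne
    refine h2 (Finset.mem_biUnion.2 ⟨j₁, Finset.mem_univ _, Finset.mem_filter.2
      ⟨hi, hj₁, hmin', j', lt_of_le_of_ne (hmin' j' h') (Ne.symm hne), h'⟩⟩)
  refine h1 (Finset.mem_filter.2 ⟨hi, hM, fun j' h' => ?_⟩)
  rw [hnone j' h', hnone j hM]

/-- Splitting `E j (∑ aᵢ yᵢ)` according to whether `n i < l` (that is `i < Q`), whether `y i` is met
by no set but `E j`, or whether it is met by several sets. -/
lemma iterNorm_restrict_comb_le (k : ℕ) (a : ℕ →₀ ℂ) (D : Finset ℕ) (hD : D ⊆ a.support)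
    (hH : H = a.support \ D) (j : Fin E.card) :
    iterNorm k (restrict (E.set j) (comb y a)) ≤
      iterNorm k (comb y (restrict (innerIndices y E H j) a)) +
      (∑ i ∈ D, ‖a i‖ * schlumprechtNorm (restrict (E.set j) (y i)) +
        ∑ i ∈ Finset.univ.biUnion (boundaryIndices y E H),
          ‖a i‖ * schlumprechtNorm (restrict (E.set j) (y i))) := by
  classical
  set B := Finset.univ.biUnion (boundaryIndices y E H) with hB
  have hBH : B ⊆ H := Finset.biUnion_subset.2 fun j _ => boundary_subset j
  have hDH : Disjoint D H := by rw [hH]; exact Finset.disjoint_sdiff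
  have hIB : ∀ i ∈ innerIndices y E H j, i ∉ B := by
    intro i hi hiB
    obtain ⟨-, h1, h2⟩ := Finset.mem_filter.1 hi
    obtain ⟨j₁, -, hj₁⟩ := Finset.mem_biUnion.1 hiB
    obtain ⟨-, h3, -, j₂, h4, h5⟩ := Finset.mem_filter.1 hj₁
    exact h4.ne ((h2 j₁ h3).trans (h2 j₂ h5).symm)
  have hsplit : restrict (E.set j) (comb y a) =
      restrict (E.set j) (comb y (restrict (innerIndices y E H j) a)) +
        ∑ i ∈ D ∪ B, a i • restrict (E.set j) (y i) := by
    have hsub : (restrict (innerIndices y E H j) a).support ⊆ a.support := by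
      rw [support_restrict]; exact Finset.inter_subset_left
    have hDB : D ∪ B ⊆ a.support := Finset.union_subset hD (hBH.trans (by
      rw [hH]; exact Finset.sdiff_subset))
    have hite : ∑ i ∈ D ∪ B, a i • restrict (E.set j) (y i) =
        ∑ i ∈ a.support, if i ∈ D ∪ B then a i • restrict (E.set j) (y i) else 0 := by
      rw [Finset.sum_ite_mem, Finset.inter_eq_right.2 hDB]
    rw [comb_eq_sum y subset_rfl, comb_eq_sum y hsub, restrict_sum, restrict_sum, hite,
      ← Finset.sum_add_distrib]
    refine Finset.sum_congr rfl fun i hi => ?_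
    rw [restrict_smul, restrict_smul, restrict_apply]
    by_cases hI : i ∈ innerIndices y E H j
    · have h1 : i ∉ D ∪ B := by
        rw [Finset.mem_union, not_or]
        exact ⟨fun h => Finset.disjoint_left.1 hDH h (inner_subset j hI), hIB i hI⟩
      rw [if_pos hI, if_neg h1, add_zero]
    · rw [if_neg hI, zero_smul, zero_add]
      split_ifs with h1
      · rfl
      · rw [Finset.mem_union, not_or] at h1
        have hiH : i ∈ H := by rw [hH]; exact Finset.mem_sdiff.2 ⟨hi, h1.1⟩
        rw [restrict_eq_zero_of_not_meets (not_meets_of_notMem hiH hI h1.2), smul_zero]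
  rw [hsplit]
  refine (iterNorm_add_le k _ _).trans (add_le_add (iterNorm_restrict_le k _ _) ?_)
  rw [← Finset.sum_union (hDH.mono_right hBH)]
  refine (iterNorm_le k _).trans ((schlumprechtNorm_sum_le _ _).trans (le_of_eq ?_))
  exact Finset.sum_congr rfl fun i _ => schlumprechtNorm_smul _ _

lemma IsRapid.sum_iterNorm_restrict_comb_le (hy : IsRapid y n) (k : ℕ) (a : ℕ →₀ ℂ) {Q : ℕ}
    (hQ : ∀ i < Q, n i < E.card) (hQ' : E.card ≤ n Q) {D : Finset ℕ}
    (hD : D = a.support.filter fun i => i < Q) (hH : H = a.support \ D) :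
    ∑ j, iterNorm k (restrict (E.set j) (comb y a)) ≤
      ∑ j, (iterNorm k (comb y (restrict (innerIndices y E H j) a)) +
        4 * schlumprechtNorm (restrict (boundaryIndices y E H j) a)) +
      2 * f E.card * schlumprechtNorm (restrict D a) := by
  classical
  have hDa : D ⊆ a.support := by rw [hD]; exact Finset.filter_subset _ _
  refine (Finset.sum_le_sum fun j _ => iterNorm_restrict_comb_le k a D hDa hH j).trans ?_
  rw [Finset.sum_add_distrib, Finset.sum_add_distrib, Finset.sum_add_distrib, add_assoc]
  refine add_le_add le_rfl ?_
  rw [add_comm]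
  refine add_le_add ?_ ?_
  · rw [Finset.sum_comm, Finset.sum_biUnion pairwiseDisjoint_boundary]
    refine Finset.sum_le_sum fun j _ => ?_
    calc ∑ i ∈ boundaryIndices y E H j, ∑ j', ‖a i‖ * schlumprechtNorm (restrict (E.set j') (y i))
        ≤ ∑ i ∈ boundaryIndices y E H j, 4 * ‖a i‖ := by
          refine Finset.sum_le_sum fun i hi => ?_
          have hiQ : E.card ≤ n i := by
            have h := boundary_subset j hi
            rw [hH, Finset.mem_sdiff, hD, Finset.mem_filter, not_and, not_lt] at h
            exact hQ'.trans (hy.strictMono.monotone (h.2 h.1))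
          rw [← Finset.mul_sum, mul_comm]
          exact mul_le_mul_of_nonneg_right (hy.sum_le i E hiQ) (norm_nonneg _)
      _ ≤ _ := by
          rw [← Finset.mul_sum]
          exact mul_le_mul_of_nonneg_left
            (sum_norm_le_of_subsingleton (hy.eq_of_mem_boundary j) a) (by norm_num)
  · rw [Finset.sum_comm]
    calc ∑ i ∈ D, ∑ j, ‖a i‖ * schlumprechtNorm (restrict (E.set j) (y i))
        ≤ ∑ i ∈ D, schlumprechtNorm (restrict D a) *
            ∑ j, schlumprechtNorm (restrict (E.set j) (y i)) := by
          refine Finset.sum_le_sum fun i hi => ?_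
          rw [← Finset.mul_sum]
          exact mul_le_mul_of_nonneg_right (norm_apply_le_of_mem hi a)
            (Finset.sum_nonneg fun j _ => schlumprechtNorm_nonneg _)
      _ ≤ schlumprechtNorm (restrict D a) *
            ∑ i ∈ Finset.range Q, ∑ j, schlumprechtNorm (restrict (E.set j) (y i)) := by
          rw [← Finset.mul_sum]
          refine mul_le_mul_of_nonneg_left (Finset.sum_le_sum_of_subset_of_nonneg ?_
            fun i _ _ => Finset.sum_nonneg fun j _ => schlumprechtNorm_nonneg _)
            (schlumprechtNorm_nonneg _)
          intro i hi
          rw [hD, Finset.mem_filter] at hi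
          exact Finset.mem_range.2 hi.2
      _ ≤ schlumprechtNorm (restrict D a) * (2 * f E.card) :=
          mul_le_mul_of_nonneg_left (hy.sum_sum_le E hQ) (schlumprechtNorm_nonneg _)
      _ = _ := mul_comm _ _

end Zones

/-- The level-`k` norm of `∑ aᵢ yᵢ` is dominated by an initial segment of `a` and a weighted family
of order `Y` behind it. -/
def Dominated (y : ℕ → ℕ →₀ ℂ) (k : ℕ) (a : ℕ →₀ ℂ) (Y ε : ℝ) : Prop :=
  ∃ (D : Finset ℕ) (L : List (Finset ℕ × ℝ)), IsFamily Y L ∧ D ⊆ a.support ∧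
    (∀ p ∈ L, p.1 ⊆ a.support) ∧ (∀ p ∈ L, Before D p.1) ∧
    iterNorm k (comb y a) ≤
      4 * (schlumprechtNorm (restrict D a) + upperConst Y * value L a) + ε

/-- The bound for one average over `l ≥ 2` successive sets, given the bounds at the level below. If
`f l ≤ Y` the families of the parts are merged into one; if `f l > Y` they are replaced by a single
set, the loss being absorbed by passing to families of the larger order `4 f l`. -/
lemma IsRapid.dominated_average {y : ℕ → ℕ →₀ ℂ} {n : ℕ → ℕ} (hy : IsRapid y n) {k : ℕ}
    (ih : ∀ a Y, 26896 ≤ Y → ∀ ε > 0, Dominated y k a Y ε) (a : ℕ →₀ ℂ) {Y : ℝ} (hY : 26896 ≤ Y)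
    {ε : ℝ} (hε : 0 < ε) (E : SuccessiveSets) (hl : 2 ≤ E.card) :
    ∃ (D : Finset ℕ) (L : List (Finset ℕ × ℝ)), IsFamily Y L ∧ D ⊆ a.support ∧
      (∀ p ∈ L, p.1 ⊆ a.support) ∧ (∀ p ∈ L, Before D p.1) ∧
      (∑ j, iterNorm k (restrict (E.set j) (comb y a))) / f E.card ≤
        4 * (schlumprechtNorm (restrict D a) + upperConst Y * value L a) + ε := by
  classical
  have hex : ∃ Q, E.card ≤ n Q := ⟨E.card, hy.strictMono.le_apply⟩
  set Q := Nat.find hex with hQdef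
  have hQ' : E.card ≤ n Q := Nat.find_spec hex
  have hQ : ∀ i < Q, n i < E.card := fun i hi => not_le.1 (Nat.find_min hex hi)
  set D := a.support.filter fun i => i < Q with hD
  set H := a.support \ D with hH
  have hDH : Before D H := by
    intro i hi i' hi'
    rw [hH, Finset.mem_sdiff, hD, Finset.mem_filter, not_and, not_lt] at hi'
    exact lt_of_lt_of_le (Finset.mem_filter.1 hi).2 (hi'.2 hi'.1)
  have hDa : D ⊆ a.support := Finset.filter_subset _ _
  have hHa : H ⊆ a.support := Finset.sdiff_subset
  have hx : 3 / 2 ≤ f E.card := f_two_ge.trans (f_mono hl)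
  have hl0 : (0 : ℝ) < E.card := by
    have : 0 < E.card := by omega
    exact_mod_cast this
  -- `Z` is the order of the families used for the parts `y i`, `i ∈ innerIndices y E H j`.
  obtain ⟨Z, hZ⟩ : ∃ Z, Z = if f E.card ≤ Y then Y else 4 * f E.card := ⟨_, rfl⟩
  have hZ0 : 26896 ≤ Z := by rw [hZ]; split_ifs <;> linarith
  choose D₁ L hL hD₁ hLs hDL hle using fun j : Fin E.card =>
    ih (restrict (innerIndices y E H j) a) Z hZ0 (ε / E.card) (by positivity)
  have hsI : ∀ j, (restrict (innerIndices y E H j) a).support ⊆ innerIndices y E H j := fun j => by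
    rw [support_restrict]; exact Finset.inter_subset_right
  set U := blocks D₁ (boundaryIndices y E H) L with hU
  have hUH : ∀ p ∈ U, p.1 ⊆ H := by
    intro p hp
    obtain ⟨j, -, hj⟩ := List.mem_flatMap.1 hp
    simp only [List.mem_cons, List.mem_append, List.not_mem_nil, or_false] at hj
    rcases hj with rfl | hj | rfl
    · exact (hD₁ j).trans ((hsI j).trans (inner_subset j))
    · exact (hLs j p hj).trans ((hsI j).trans (inner_subset j))
    · exact boundary_subset j
  have hUpair : U.Pairwise fun p q => Before p.1 q.1 :=
    pairwise_blocks hL (fun i j hij => hy.before_zones hij)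
      (fun j => ((hD₁ j).trans (hsI j)).trans Finset.subset_union_left)
      (fun j => Finset.subset_union_right)
      (fun j p hp => ((hLs j p hp).trans (hsI j)).trans Finset.subset_union_left) hDL
      (fun j p hp => (hy.before_inner_boundary j).mono ((hLs j p hp).trans (hsI j)) subset_rfl)
      (fun j => (hy.before_inner_boundary j).mono ((hD₁ j).trans (hsI j)) subset_rfl)
  have hUw : ∀ p ∈ U, 0 ≤ p.2 ∧ p.2 ≤ 1 := weight_mem_blocks hL
  have hUc := count_blocks_le (D := D₁) (D' := boundaryIndices y E H) hL
  have hK := one_le_upperConst Z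
  have hsum : (∑ j, iterNorm k (restrict (E.set j) (comb y a))) / f E.card ≤
      4 * (schlumprechtNorm (restrict D a) + upperConst Z * (value U a / f E.card)) + ε := by
    have h1 := hy.sum_iterNorm_restrict_comb_le k a hQ hQ' hD hH
    have h2 : ∑ j, (iterNorm k (comb y (restrict (innerIndices y E H j) a)) +
        4 * schlumprechtNorm (restrict (boundaryIndices y E H j) a)) ≤
        4 * (upperConst Z * value U a) + ε := by
      have h3 : ε = ∑ _j : Fin E.card, ε / E.card := by
        rw [Finset.sum_const, Finset.card_univ, Fintype.card_fin, nsmul_eq_mul]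
        field_simp
      rw [hU, value_blocks, Finset.mul_sum, Finset.mul_sum, h3, ← Finset.sum_add_distrib]
      refine Finset.sum_le_sum fun j _ => ?_
      have h4 := hle j
      rw [restrict_restrict_of_subset ((hD₁ j).trans (hsI j)),
        value_restrict fun p hp => (hLs j p hp).trans (hsI j)] at h4
      have h5 := schlumprechtNorm_nonneg (restrict (D₁ j) a)
      have h6 := schlumprechtNorm_nonneg (restrict (boundaryIndices y E H j) a)
      nlinarith
    have h7 := schlumprechtNorm_nonneg (restrict D a)
    rw [div_le_iff₀ (by linarith)]
    have h8 : upperConst Z * (value U a / f E.card) * f E.card = upperConst Z * value U a := by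
      field_simp
    nlinarith
  by_cases hlY : f E.card ≤ Y
  · rw [if_pos hlY] at hZ
    subst hZ
    refine ⟨D, U.map fun p => (p.1, p.2 / f E.card), isFamily_of_blocks hl hlY hUpair hUw hUc, hDa,
      ?_, ?_, ?_⟩
    · intro p hp
      obtain ⟨q, hq, rfl⟩ := List.mem_map.1 hp
      exact (hUH q hq).trans hHa
    · intro p hp
      obtain ⟨q, hq, rfl⟩ := List.mem_map.1 hp
      exact hDH.mono subset_rfl (hUH q hq)
    · rwa [value_scale]
  · rw [if_neg hlY] at hZ
    push Not at hlY
    refine ⟨D, [(H, 1)], isFamily_singleton H, hDa, by simpa using hHa, by simpa using hDH,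
      hsum.trans ?_⟩
    have h1 := value_le_of_blocks (by linarith) hUpair hUw hUc (restrict H a)
    rw [value_restrict hUH] at h1
    have h2 : upperConst Z * (value U a / f E.card) ≤
        upperConst Y * schlumprechtNorm (restrict H a) := by
      calc upperConst Z * (value U a / f E.card)
          ≤ upperConst Z * (((f E.card + 2 + 40 * √Z) * schlumprechtNorm (restrict H a)) /
              f E.card) := by gcongr
        _ = upperConst Z * (f E.card + 2 + 40 * √Z) / f E.card *
              schlumprechtNorm (restrict H a) := by ring
        _ ≤ upperConst Y * schlumprechtNorm (restrict H a) := by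
          refine mul_le_mul_of_nonneg_right ?_ (schlumprechtNorm_nonneg _)
          rw [hZ]
          exact (upperConst_four_mul_le (by linarith)).trans
            (upperConst_anti (by linarith) hlY.le)
    have h3 : value [(H, (1 : ℝ))] a = schlumprechtNorm (restrict H a) := by simp [value]
    rw [h3]
    linarith

lemma IsRapid.dominated {y : ℕ → ℕ →₀ ℂ} {n : ℕ → ℕ} (hy : IsRapid y n) (k : ℕ) :
    ∀ a Y, 26896 ≤ Y → ∀ ε > 0, Dominated y k a Y ε := by
  induction k with
  | zero =>
    intro a Y _ ε hε
    refine ⟨a.support, [], isFamily_nil, subset_rfl, by simp, by simp, ?_⟩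
    rw [restrict_of_support_subset subset_rfl]
    have h0 := schlumprechtNorm_nonneg a
    have h : iterNorm 0 (comb y a) ≤ schlumprechtNorm a := by
      refine ciSup_le fun b => ?_
      rw [comb_eq_sum y subset_rfl, Finsupp.finsetSum_apply]
      by_cases hb : ∃ i ∈ a.support, b ∈ (y i).support
      · obtain ⟨i, hi, hbi⟩ := hb
        rw [Finset.sum_eq_single_of_mem i hi]
        · rw [Finsupp.smul_apply, norm_smul]
          exact (mul_le_of_le_one_right (norm_nonneg _)
            ((norm_apply_le_schlumprechtNorm _ _).trans (hy.norm_le i))).trans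
            (norm_apply_le_schlumprechtNorm a i)
        · intro i' _ hne
          have hb0 : b ∉ (y i').support := fun hb' => ?_
          · rw [Finsupp.smul_apply, Finsupp.notMem_support_iff.1 hb0, smul_zero]
          rcases lt_or_gt_of_ne hne with h | h
          · exact lt_irrefl _ (hy.before _ _ h b hb' b hbi)
          · exact lt_irrefl _ (hy.before _ _ h b hbi b hb')
      · push Not at hb
        rw [Finset.sum_eq_zero, norm_zero]
        · exact h0
        · intro i hi
          rw [Finsupp.smul_apply, Finsupp.notMem_support_iff.1 (hb i hi), smul_zero]
    simp only [value, List.map_nil, List.sum_nil]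
    linarith
  | succ k ih =>
    intro a Y hY ε hε
    obtain ⟨E, hE⟩ := exists_lt_of_lt_ciSup
      (show iterNorm (k + 1) (comb y a) - ε / 2 < iterNorm (k + 1) (comb y a) by linarith)
    -- The supremum over the averages need not be attained, whence the term `ε`.
    rcases E.one_le_card.eq_or_lt with h1 | h2
    · obtain ⟨D, L, hL, hD, hLa, hDL, hle⟩ := ih a Y hY (ε / 2) (by linarith)
      refine ⟨D, L, hL, hD, hLa, hDL, ?_⟩
      have h3 : (∑ i, iterNorm k (restrict (E.set i) (comb y a))) / f E.card ≤
          iterNorm k (comb y a) := by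
        rw [show f E.card = 1 by rw [← h1, f_one], div_one]
        refine (Finset.sum_le_card_nsmul _ _ _ fun i _ => iterNorm_restrict_le k _ _).trans ?_
        simp [← h1]
      linarith
    · obtain ⟨D, L, hL, hD, hLa, hDL, hle⟩ := hy.dominated_average ih a hY (half_pos hε) E h2
      exact ⟨D, L, hL, hD, hLa, hDL, by linarith⟩

/-- Rapidly increasing averages are dominated by the unit vector basis. -/
theorem IsRapid.schlumprechtNorm_comb_le : ∃ C : ℝ, ∀ (y : ℕ → ℕ →₀ ℂ) (n : ℕ → ℕ),
    IsRapid y n → ∀ a, schlumprechtNorm (comb y a) ≤ C * schlumprechtNorm a := by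
  refine ⟨4 * (1 + upperConst 26896 * (3 + 40 * √26896)), fun y n hy a => ?_⟩
  refine schlumprechtNorm_le fun k => le_of_forall_pos_le_add fun ε hε => ?_
  obtain ⟨D, L, hL, -, -, -, hle⟩ := hy.dominated k a 26896 le_rfl ε hε
  refine hle.trans (add_le_add ?_ le_rfl)
  rw [mul_assoc]
  refine mul_le_mul_of_nonneg_left ?_ (by norm_num)
  rw [add_mul, one_mul, mul_assoc]
  refine add_le_add (schlumprechtNorm_restrict_le _ _) ?_
  exact mul_le_mul_of_nonneg_left (hL.value_le (by norm_num) a)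
    (zero_le_one.trans (one_le_upperConst _))

end UpperEstimate

/-! ### Averages in normalized block sequences -/

section Averages

/-- A sequence of norm-one vectors with successive supports. -/
structure IsNormalizedBlock (x : ℕ → ℕ →₀ ℂ) : Prop where
  before : ∀ i j, i < j → Before (x i).support (x j).support
  norm_eq : ∀ i, schlumprechtNorm (x i) = 1

lemma restrict_eq_zero {E : Finset ℕ} {x : ℕ →₀ ℂ} (h : ∀ b ∈ E, b ∉ x.support) :
    restrict E x = 0 := by
  ext b
  rw [restrict_apply]
  split_ifs with hb
  · exact Finsupp.notMem_support_iff.1 (h b hb)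
  · rfl

lemma restrict_support_comb {y : ℕ → ℕ →₀ ℂ}
    (hy : ∀ i j, i < j → Before (y i).support (y j).support) (a : ℕ →₀ ℂ) (i : ℕ) :
    restrict (y i).support (comb y a) = a i • y i := by
  classical
  rw [comb_eq_sum y (Finset.subset_insert i a.support), restrict_sum,
    Finset.sum_eq_single_of_mem i (Finset.mem_insert_self _ _)]
  · rw [restrict_smul, restrict_of_support_subset subset_rfl]
  · intro j _ hne
    rw [restrict_smul, restrict_eq_zero, smul_zero]
    intro b hb hb'
    rcases lt_or_gt_of_ne hne with h | h
    · exact lt_irrefl _ (hy _ _ h b hb' b hb)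
    · exact lt_irrefl _ (hy _ _ h b hb b hb')

lemma IsNormalizedBlock.norm_apply_le {x : ℕ → ℕ →₀ ℂ} (hx : IsNormalizedBlock x) (a : ℕ →₀ ℂ)
    (i : ℕ) : ‖a i‖ ≤ schlumprechtNorm (comb x a) := by
  have h := schlumprechtNorm_restrict_le (x i).support (comb x a)
  rwa [restrict_support_comb hx.before, schlumprechtNorm_smul, hx.norm_eq, mul_one] at h

lemma exists_of_mem_support_comb {y : ℕ → ℕ →₀ ℂ} {a : ℕ →₀ ℂ} {b : ℕ}
    (hb : b ∈ (comb y a).support) : ∃ i ∈ a.support, b ∈ (y i).support := by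
  by_contra! h
  refine Finsupp.mem_support_iff.1 hb ?_
  rw [comb_eq_sum y subset_rfl, Finsupp.finsetSum_apply]
  refine Finset.sum_eq_zero fun i hi => ?_
  rw [Finsupp.smul_apply, Finsupp.notMem_support_iff.1 (h i hi), smul_zero]

lemma before_comb {y : ℕ → ℕ →₀ ℂ} (hy : ∀ i j, i < j → Before (y i).support (y j).support)
    {a a' : ℕ →₀ ℂ} (h : Before a.support a'.support) :
    Before (comb y a).support (comb y a').support := by
  intro b hb b' hb'
  obtain ⟨i, hi, hbi⟩ := exists_of_mem_support_comb hb
  obtain ⟨i', hi', hbi'⟩ := exists_of_mem_support_comb hb'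
  exact hy i i' (h i hi i' hi') b hbi b' hbi'

/-- Sums of `n` successive vectors behave like `ℓ₁`-sums over at most `n` successive sets. There
are at most `2 n` pairs `(i, j)` such that `E j` meets the `i`-th vector, as `i + j` determines the
pair. -/
lemma sum_restrict_sum_le {z : ℕ → ℕ →₀ ℂ}
    (hz : ∀ i j, i < j → Before (z i).support (z j).support) {β : ℝ} (hβ : 0 ≤ β)
    (hzβ : ∀ i, schlumprechtNorm (z i) ≤ β) {n : ℕ} (E : SuccessiveSets) (hE : E.card ≤ n) :
    ∑ j, schlumprechtNorm (restrict (E.set j) (∑ i ∈ Finset.range n, z i)) ≤ 2 * n * β := by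
  classical
  set P := (Finset.range n ×ˢ (Finset.univ : Finset (Fin E.card))).filter
    fun p => Meets z E p.1 p.2 with hP
  have hcard : P.card ≤ 2 * n := by
    rw [← Finset.card_range (2 * n)]
    refine Finset.card_le_card_of_injOn (fun p => p.1 + p.2) ?_ ?_
    · intro p hp
      have h := Finset.mem_filter.1 (Finset.mem_coe.1 hp)
      have h1 := Finset.mem_range.1 (Finset.mem_product.1 h.1).1
      have h2 := p.2.isLt
      simp only [Finset.coe_range, Set.mem_Iio]
      omega
    · rintro ⟨i, j⟩ hp ⟨i', j'⟩ hp' heq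
      have h := (Finset.mem_filter.1 (Finset.mem_coe.1 hp)).2
      have h' := (Finset.mem_filter.1 (Finset.mem_coe.1 hp')).2
      simp only at h h' heq
      have hii : i = i' := by
        rcases lt_trichotomy i i' with hlt | heq' | hlt
        · have := Fin.le_def.1 (le_of_meets hz hlt h h')
          omega
        · exact heq'
        · have := Fin.le_def.1 (le_of_meets hz hlt h' h)
          omega
      subst hii
      exact Prod.ext rfl (Fin.ext (by simpa using heq))
  calc ∑ j, schlumprechtNorm (restrict (E.set j) (∑ i ∈ Finset.range n, z i))
      ≤ ∑ j, ∑ i ∈ Finset.range n, schlumprechtNorm (restrict (E.set j) (z i)) :=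
        Finset.sum_le_sum fun j _ => by rw [restrict_sum]; exact schlumprechtNorm_sum_le _ _
    _ = ∑ p ∈ Finset.range n ×ˢ (Finset.univ : Finset (Fin E.card)),
          schlumprechtNorm (restrict (E.set p.2) (z p.1)) := by
        rw [Finset.sum_comm, Finset.sum_product]
    _ = ∑ p ∈ P, schlumprechtNorm (restrict (E.set p.2) (z p.1)) := by
        rw [hP, Finset.sum_filter]
        refine Finset.sum_congr rfl fun p _ => ?_
        split_ifs with h
        · rfl
        · rw [restrict_eq_zero_of_not_meets h, schlumprechtNorm_zero]
    _ ≤ P.card • β := Finset.sum_le_card_nsmul _ _ _ fun p _ =>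
        (schlumprechtNorm_restrict_le _ _).trans (hzβ _)
    _ ≤ 2 * n * β := by
        rw [nsmul_eq_mul]
        exact mul_le_mul_of_nonneg_right (by exact_mod_cast hcard) hβ

/-- The indicator of `{s, …, s + m - 1}`. -/
noncomputable def indicator (s m : ℕ) : ℕ →₀ ℂ := ∑ k ∈ Finset.range m, Finsupp.single (s + k) 1

lemma indicator_apply (s m i : ℕ) : indicator s m i = if s ≤ i ∧ i < s + m then 1 else 0 := by
  rw [indicator, Finsupp.finsetSum_apply]
  split_ifs with h
  · rw [Finset.sum_eq_single_of_mem (i - s) (Finset.mem_range.2 (by omega))]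
    · rw [Nat.add_sub_cancel' h.1, Finsupp.single_eq_same]
    · intro k _ hk
      exact Finsupp.single_eq_of_ne (by omega)
  · refine Finset.sum_eq_zero fun k hk => Finsupp.single_eq_of_ne ?_
    have := Finset.mem_range.1 hk
    omega

lemma mem_support_indicator {s m i : ℕ} : i ∈ (indicator s m).support ↔ s ≤ i ∧ i < s + m := by
  rw [Finsupp.mem_support_iff, indicator_apply]
  simp

lemma indicator_mul (s n m : ℕ) :
    indicator s (n * m) = ∑ i ∈ Finset.range n, indicator (s + i * m) m := by
  induction n with
  | zero => simp [indicator]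
  | succ n ih =>
    rw [Finset.sum_range_succ, ← ih, Nat.succ_mul, indicator, Finset.sum_range_add, indicator,
      indicator]
    simp only [add_assoc]

lemma IsNormalizedBlock.le_norm_comb_indicator {x : ℕ → ℕ →₀ ℂ} (hx : IsNormalizedBlock x)
    (s : ℕ) {m : ℕ} (hm : 1 ≤ m) :
    (m : ℝ) ≤ f m * schlumprechtNorm (comb x (indicator s m)) := by
  have h := sum_schlumprechtNorm_restrict_le ⟨m, hm, fun j => (x (s + j)).support,
    fun i j hij a ha b hb => hx.before _ _ (by simpa using hij) a ha b hb⟩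
    (comb x (indicator s m))
  refine le_trans (le_of_eq ?_) h
  have h1 : ∀ j : Fin m, schlumprechtNorm (restrict (x (s + j)).support
      (comb x (indicator s m))) = 1 := by
    intro j
    rw [restrict_support_comb hx.before, indicator_apply, if_pos ⟨by omega, by omega⟩, one_smul,
      hx.norm_eq]
  simp [h1]

lemma exists_f_pow_lt_two_pow (n : ℕ) : ∃ r : ℕ, f (n ^ r) < 2 ^ r := by
  have h1 : ∀ r : ℕ, 1 ≤ r → f (n ^ r) ≤ r * f n := by
    intro r hr
    rw [f, f, ← Real.logb_pow]
    refine Real.logb_le_logb_of_le (by norm_num) (by positivity) ?_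
    have := pow_add_pow_le (Nat.cast_nonneg n : (0 : ℝ) ≤ n) zero_le_one (by omega : r ≠ 0)
    simpa using this
  have h2 := tendsto_pow_const_div_const_pow_of_one_lt 1 (by norm_num : (1 : ℝ) < 2)
  have h3 := h2.mul_const (f n)
  rw [zero_mul] at h3
  obtain ⟨r, hr, hr1⟩ := ((h3.eventually (gt_mem_nhds one_pos)).and
    (Filter.eventually_ge_atTop 1)).exists
  refine ⟨r, (h1 r hr1).trans_lt ?_⟩
  rw [pow_one, div_mul_eq_mul_div, div_lt_one (by positivity)] at hr
  exact hr

/-- James's argument: blocks of every normalized block sequence contain `ℓ₁`-averages of every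
length, since otherwise the sums of `n ^ r` terms would have norm at most `(n / 2) ^ r`, less than
the lower bound `n ^ r / f (n ^ r)`. -/
lemma IsNormalizedBlock.exists_average {x : ℕ → ℕ →₀ ℂ} (hx : IsNormalizedBlock x) (n M : ℕ)
    (hn : 1 ≤ n) : ∃ c : ℕ →₀ ℂ, (∀ i ∈ c.support, M ≤ i) ∧ schlumprechtNorm (comb x c) = 1 ∧
      ∀ E : SuccessiveSets, E.card ≤ n →
        ∑ j, schlumprechtNorm (restrict (E.set j) (comb x c)) ≤ 4 := by
  have hn0 : (0 : ℝ) < n := by exact_mod_cast hn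
  obtain ⟨r, hP, hr⟩ : ∃ r : ℕ,
      (∀ s, M ≤ s → schlumprechtNorm (comb x (indicator s (n ^ r))) ≤ (n / 2 : ℝ) ^ r) ∧
      ¬ ∀ s, M ≤ s →
        schlumprechtNorm (comb x (indicator s (n ^ (r + 1)))) ≤ (n / 2 : ℝ) ^ (r + 1) := by
    by_contra! hcon
    have hall : ∀ r : ℕ, ∀ s, M ≤ s →
        schlumprechtNorm (comb x (indicator s (n ^ r))) ≤ (n / 2 : ℝ) ^ r := by
      intro r
      induction r with
      | zero =>
        intro s _
        have h1 : comb x (indicator s (n ^ 0)) = x s := by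
          simp [comb, indicator]
        rw [h1, hx.norm_eq, pow_zero]
      | succ r ih => exact hcon r ih
    obtain ⟨r, hr⟩ := exists_f_pow_lt_two_pow n
    have h1 := hx.le_norm_comb_indicator M (m := n ^ r) (Nat.one_le_pow _ _ hn)
    have h2 := h1.trans (mul_le_mul_of_nonneg_left (hall r M le_rfl) (f_nonneg _))
    have h3 : (0 : ℝ) < (n / 2 : ℝ) ^ r := by positivity
    have h4 := h2.trans_lt (mul_lt_mul_of_pos_right hr h3)
    rw [← mul_pow, mul_div_cancel₀ _ (by norm_num)] at h4
    push_cast at h4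
    exact lt_irrefl _ h4
  push Not at hr
  obtain ⟨s, hs, hlt⟩ := hr
  set ν := schlumprechtNorm (comb x (indicator s (n ^ (r + 1)))) with hν
  have hβ : (0 : ℝ) < (n / 2 : ℝ) ^ r := by positivity
  have hν0 : 0 < ν := lt_trans (by positivity) hlt
  have hz : ∀ i j, i < j → Before (comb x (indicator (s + i * n ^ r) (n ^ r))).support
      (comb x (indicator (s + j * n ^ r) (n ^ r))).support := by
    intro i j hij
    refine before_comb hx.before fun b hb b' hb' => ?_
    have h1 := (mem_support_indicator.1 hb).2
    have h2 := (mem_support_indicator.1 hb').1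
    have h3 : (i + 1) * n ^ r ≤ j * n ^ r := Nat.mul_le_mul_right _ hij
    rw [Nat.succ_mul] at h3
    omega
  have hcomb : comb x ((ν : ℂ)⁻¹ • indicator s (n ^ (r + 1))) =
      (ν : ℂ)⁻¹ • ∑ i ∈ Finset.range n, comb x (indicator (s + i * n ^ r) (n ^ r)) := by
    rw [pow_succ', indicator_mul, comb, map_smul, map_sum]
    rfl
  have hνnorm : ‖(ν : ℂ)⁻¹‖ = ν⁻¹ := by
    rw [norm_inv, Complex.norm_real, Real.norm_of_nonneg hν0.le]
  refine ⟨(ν : ℂ)⁻¹ • indicator s (n ^ (r + 1)), fun i hi => ?_, ?_, fun E hE => ?_⟩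
  · exact hs.trans (mem_support_indicator.1 (Finsupp.support_smul hi)).1
  · rw [comb, map_smul, schlumprechtNorm_smul, hνnorm]
    exact inv_mul_cancel₀ hν0.ne'
  · rw [hcomb]
    simp_rw [restrict_smul, schlumprechtNorm_smul, hνnorm]
    rw [← Finset.mul_sum, inv_mul_le_iff₀ hν0]
    refine (sum_restrict_sum_le hz hβ.le (fun i => hP _ (by omega)) E hE).trans ?_
    rw [pow_succ] at hlt
    nlinarith

lemma le_f_two_pow (k : ℕ) : (k : ℝ) ≤ f (2 ^ k) := by
  rw [f, Real.le_logb_iff_rpow_le (by norm_num) (by positivity), Real.rpow_natCast]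
  push_cast
  linarith

/-- Every normalized block sequence has a block subsequence of rapidly increasing averages. -/
lemma IsNormalizedBlock.exists_isRapid {x : ℕ → ℕ →₀ ℂ} (hx : IsNormalizedBlock x) :
    ∃ (c : ℕ → ℕ →₀ ℂ) (n : ℕ → ℕ), IsRapid (fun i => comb x (c i)) n ∧
      (∀ i, schlumprechtNorm (comb x (c i)) = 1) ∧ ∀ i, ∀ k ∈ (c i).support, i ≤ k := by
  obtain ⟨p, hp, hpr⟩ := exists_seq_of_forall_finset_exists
    (fun p : (ℕ →₀ ℂ) × ℕ × ℕ => (∀ i ∈ p.1.support, p.2.2 ≤ i) ∧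
      schlumprechtNorm (comb x p.1) = 1 ∧ ∀ E : SuccessiveSets, E.card ≤ p.2.1 →
        ∑ j, schlumprechtNorm (restrict (E.set j) (comb x p.1)) ≤ 4)
    (fun p q => Before p.1.support q.1.support ∧ p.2.1 < q.2.1 ∧ p.2.2 < q.2.2 ∧
      2 * f p.2.1 ≤ f q.2.1 ∧ 2 * l1 (comb x p.1) ≤ f q.2.1) (fun S _ => by
    classical
    obtain ⟨M, hM⟩ := (S.biUnion fun p => insert p.2.2 p.1.support).exists_le
    obtain ⟨k, hk⟩ := (S.image fun p =>
      max p.2.1 (max ⌈2 * f p.2.1⌉₊ ⌈2 * l1 (comb x p.1)⌉₊)).exists_le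
    obtain ⟨c, hc⟩ := hx.exists_average (2 ^ k) (M + 1) Nat.one_le_two_pow
    refine ⟨(c, 2 ^ k, M + 1), hc, fun q hq => ?_⟩
    have h1 := hk _ (Finset.mem_image_of_mem _ hq)
    have h2 : ∀ i ∈ insert q.2.2 q.1.support, i ≤ M := fun i hi =>
      hM i (Finset.mem_biUnion.2 ⟨q, hq, hi⟩)
    -- `f (2 ^ k) ≥ k` exceeds all the bounds to be satisfied.
    rw [max_le_iff, max_le_iff, Nat.ceil_le, Nat.ceil_le] at h1
    refine ⟨fun b hb b' hb' => ?_, h1.1.trans_lt Nat.lt_two_pow_self, ?_,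
      h1.2.1.trans (le_f_two_pow k), h1.2.2.trans (le_f_two_pow k)⟩
    · exact Nat.lt_of_lt_of_le (Nat.lt_succ_of_le (h2 b (Finset.mem_insert_of_mem hb)))
        (hc.1 b' hb')
    · exact Nat.lt_succ_of_le (h2 _ (Finset.mem_insert_self _ _)))
  have hM : StrictMono fun i => (p i).2.2 := fun i j hij => (hpr i j hij).2.2.1
  refine ⟨fun i => (p i).1, fun i => (p i).2.1, ⟨fun i j hij => before_comb hx.before
    (hpr i j hij).1, fun i => (hp i).2.1.le, fun i j hij => (hpr i j hij).2.1,
    fun i => (hp i).2.2, fun q => ?_⟩, fun i => (hp i).2.1,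
    fun i k hk => hM.le_apply.trans ((hp i).1 k hk)⟩
  induction q with
  | zero => simpa using f_nonneg _
  | succ q ih =>
    rw [Finset.sum_range_succ]
    obtain ⟨-, -, -, h1, h2⟩ := hpr q (q + 1) (Nat.lt_succ_self q)
    linarith

end Averages

/-! ### Operators on the completion -/

section Embedding

/-- The canonical embedding of `c₀₀` into Schlumprecht's space. -/
noncomputable def emb : (ℕ →₀ ℂ) →ₗ[ℂ] SchlumprechtSpace where
  toFun x := ((show C00 from x : C00) : UniformSpace.Completion C00)
  map_add' x y := UniformSpace.Completion.coe_add (show C00 from x) (show C00 from y)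
  map_smul' c x := UniformSpace.Completion.coe_smul c (show C00 from x)

lemma norm_emb (x : ℕ →₀ ℂ) : ‖emb x‖ = schlumprechtNorm x :=
  UniformSpace.Completion.norm_coe (show C00 from x)

lemma denseRange_emb : DenseRange emb := UniformSpace.Completion.denseRange_coe (α := C00)

variable {F : Type*} [NormedAddCommGroup F] [NormedSpace ℂ F]

lemma exists_extension [CompleteSpace F] (T : (ℕ →₀ ℂ) →ₗ[ℂ] F) (C : ℝ)
    (h : ∀ x, ‖T x‖ ≤ C * schlumprechtNorm x) :
    ∃ T' : SchlumprechtSpace →L[ℂ] F, (∀ x, T' (emb x) = T x) ∧ ∀ z, ‖T' z‖ ≤ C * ‖z‖ := by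
  have h' : ∀ x, ‖T x‖ ≤ C * ‖emb x‖ := fun x => by rw [norm_emb]; exact h x
  exact ⟨T.extendOfNorm emb, LinearMap.extendOfNorm_eq denseRange_emb ⟨C, h'⟩,
    LinearMap.norm_extendOfNorm_apply_le denseRange_emb C h'⟩

lemma eq_of_comp_emb {A B : SchlumprechtSpace →L[ℂ] F} (h : ∀ x, A (emb x) = B (emb x)) : A = B :=
  DFunLike.coe_injective (denseRange_emb.equalizer A.continuous B.continuous (funext h))

lemma norm_le_of_comp_emb (A : SchlumprechtSpace →L[ℂ] F) {C : ℝ} (hC : 0 ≤ C)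
    (h : ∀ x, ‖A (emb x)‖ ≤ C * schlumprechtNorm x) : ‖A‖ ≤ C := by
  refine A.opNorm_le_bound hC fun z => ?_
  refine denseRange_emb.induction_on (p := fun z => ‖A z‖ ≤ C * ‖z‖) z
    (isClosed_le (by fun_prop) (by fun_prop)) fun x => ?_
  rw [norm_emb]
  exact h x

end Embedding

/-! ### The square of Schlumprecht's space -/

section Square

lemma mapDomain_le {φ : ℕ → ℕ} (hφ : StrictMono φ) (x : ℕ →₀ ℂ) :
    schlumprechtNorm (Finsupp.mapDomain φ x) ≤ schlumprechtNorm x := by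
  refine schlumprechtNorm_le_of_norm_apply_le
    (E := fun i => ({i} : Finset ℕ).preimage φ hφ.injective.injOn) ?_ fun i => ?_
  · intro i j hij a ha b hb
    rw [Finset.mem_preimage, Finset.mem_singleton] at ha hb
    rw [← hφ.lt_iff_lt, ha, hb]
    exact hij
  · by_cases hi : i ∈ Set.range φ
    · obtain ⟨m, rfl⟩ := hi
      rw [Finsupp.mapDomain_apply hφ.injective]
      exact norm_apply_le_of_mem (by simp) x
    · rw [Finsupp.mapDomain_of_notMem_range _ _ hi, norm_zero]
      exact schlumprechtNorm_nonneg _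

lemma comapDomain_le {φ : ℕ → ℕ} (hφ : StrictMono φ) (x : ℕ →₀ ℂ) :
    schlumprechtNorm (Finsupp.comapDomain φ x hφ.injective.injOn) ≤ schlumprechtNorm x := by
  refine schlumprechtNorm_le_of_norm_apply_le (E := fun i => {φ i}) ?_ fun i => ?_
  · intro i j hij a ha b hb
    rw [Finset.mem_singleton] at ha hb
    rw [ha, hb]
    exact hφ hij
  · exact norm_apply_le_of_mem (Finset.mem_singleton_self (φ i)) x

/-- The operators `e m ↦ e (φ m)` and `x ↦ x ∘ φ` are bounded. -/
lemma exists_spread {φ : ℕ → ℕ} (hφ : StrictMono φ) :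
    ∃ u v : SchlumprechtSpace →L[ℂ] SchlumprechtSpace,
      (∀ x, u (emb x) = emb (Finsupp.mapDomain φ x)) ∧
      ∀ x, v (emb x) = emb (Finsupp.comapDomain φ x hφ.injective.injOn) := by
  obtain ⟨u, hu, -⟩ := exists_extension (emb ∘ₗ Finsupp.lmapDomain ℂ ℂ φ) 1 fun x => by
    simpa [norm_emb] using mapDomain_le hφ x
  obtain ⟨v, hv, -⟩ := exists_extension (emb ∘ₗ Finsupp.lcomapDomain φ hφ.injective) 1
    fun x => by simpa [norm_emb, Finsupp.lcomapDomain] using comapDomain_le hφ x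
  exact ⟨u, v, hu, hv⟩

lemma hasComplementedSquare : HasComplementedSquare SchlumprechtSpace := by
  have h0 : StrictMono fun n : ℕ => 2 * n := fun a b h => by simpa using h
  have h1 : StrictMono fun n : ℕ => 2 * n + 1 := fun a b h => by simpa using h
  obtain ⟨u₀, v₀, hu₀, hv₀⟩ := exists_spread h0
  obtain ⟨u₁, v₁, hu₁, hv₁⟩ := exists_spread h1
  have h00 : ∀ z, v₀ (u₀ z) = z := DFunLike.congr_fun (eq_of_comp_emb
    (A := v₀ * u₀) (B := 1) fun x => by
      simp [hu₀, hv₀, Finsupp.comapDomain_mapDomain _ h0.injective])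
  have h11 : ∀ z, v₁ (u₁ z) = z := DFunLike.congr_fun (eq_of_comp_emb
    (A := v₁ * u₁) (B := 1) fun x => by
      simp [hu₁, hv₁, Finsupp.comapDomain_mapDomain _ h1.injective])
  have h01 : ∀ z, v₀ (u₁ z) = 0 := DFunLike.congr_fun (eq_of_comp_emb
    (A := v₀ * u₁) (B := 0) fun x => by
      rw [mul_apply_eq_comp, hu₁, hv₀, zero_apply]
      convert map_zero emb
      ext n
      rw [Finsupp.comapDomain_apply, Finsupp.mapDomain_of_notMem_range]
      · rfl
      · rintro ⟨m, hm⟩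
        simp only at hm
        omega)
  have h10 : ∀ z, v₁ (u₀ z) = 0 := DFunLike.congr_fun (eq_of_comp_emb
    (A := v₁ * u₀) (B := 0) fun x => by
      rw [mul_apply_eq_comp, hu₀, hv₁, zero_apply]
      convert map_zero emb
      ext n
      rw [Finsupp.comapDomain_apply, Finsupp.mapDomain_of_notMem_range]
      · rfl
      · rintro ⟨m, hm⟩
        simp only at hm
        omega)
  exact ⟨_, complemented_range_of_leftInverse (u₀.coprod u₁) (v₀.prod v₁) fun p => by
    ext <;> simp [h00, h11, h01, h10]⟩

end Square

/-! ### Averages near infinite-dimensional subspaces -/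

section Subspaces

/-- An infinite-dimensional subspace contains almost a normalized finitely supported vector which
vanishes on the first `M` coordinates. -/
lemma exists_near_of_not_finiteDimensional {W : Submodule ℂ SchlumprechtSpace}
    (hW : ¬ FiniteDimensional ℂ W) (M : ℕ) {δ : ℝ} (hδ : 0 < δ) :
    ∃ x : ℕ →₀ ℂ, schlumprechtNorm x = 1 ∧ (∀ b ∈ x.support, M ≤ b) ∧
      ∃ w ∈ W, ‖emb x - w‖ ≤ δ := by
  choose coord hcoord hcoord_le using fun i : ℕ => exists_extension (F := ℂ)
    (Finsupp.lapply i) 1 fun x => by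
      simpa using norm_apply_le_schlumprechtNorm x i
  -- a unit vector of `W` whose first `M` coordinates vanish
  obtain ⟨w, hwW, hw1, hw0⟩ : ∃ w ∈ W, ‖w‖ = 1 ∧ ∀ i < M, coord i w = 0 := by
    let Φ : W →ₗ[ℂ] (Fin M → ℂ) := LinearMap.pi fun i => (coord i).toLinearMap ∘ₗ W.subtype
    have hΦ : ¬ Function.Injective Φ := fun h => hW (FiniteDimensional.of_injective Φ h)
    rw [← LinearMap.ker_eq_bot, ← ne_eq, Submodule.ne_bot_iff] at hΦ
    obtain ⟨v, hv, hv0⟩ := hΦ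
    have hn : ‖(v : SchlumprechtSpace)‖ ≠ 0 := by simpa using hv0
    refine ⟨((‖(v : SchlumprechtSpace)‖ : ℂ)⁻¹) • (v : SchlumprechtSpace),
      W.smul_mem _ v.2, ?_, fun i hi => ?_⟩
    · rw [norm_smul, norm_inv, Complex.norm_real, norm_norm, inv_mul_cancel₀ hn]
    · have := congrFun (LinearMap.mem_ker.1 hv) ⟨i, hi⟩
      have h2 : coord i (v : SchlumprechtSpace) = 0 := this
      rw [map_smul, h2, smul_zero]
  have hM0 : (0 : ℝ) < M + 1 := by positivity
  obtain ⟨η, hη0, hη1, hηδ⟩ : ∃ η : ℝ, 0 < η ∧ (M + 1) * η < 1 ∧ 2 * ((M + 1) * η) ≤ δ := by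
    refine ⟨min (1 / 2) (δ / 2) / (M + 1), by positivity, ?_, ?_⟩ <;>
    rw [mul_div_cancel₀ _ hM0.ne']
    · exact (min_le_left _ _).trans_lt (by norm_num)
    · linarith [min_le_right (1 / 2) (δ / 2)]
  obtain ⟨v, hv⟩ := denseRange_emb.exists_dist_lt w hη0
  rw [dist_eq_norm, norm_sub_rev] at hv
  set v' := restrict (v.support \ Finset.range M) v with hv'
  have hhead : schlumprechtNorm (v - v') ≤ M * η := by
    refine (schlumprechtNorm_le_l1 _).trans ?_
    have hsub : (v - v').support ⊆ Finset.range M := by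
      intro b hb
      by_contra hbM
      refine Finsupp.mem_support_iff.1 hb ?_
      rw [Finsupp.sub_apply, hv', restrict_apply]
      split_ifs with h
      · exact sub_self _
      · rw [Finset.mem_sdiff, not_and_not_right] at h
        have : b ∉ v.support := fun h' => hbM (h h')
        rw [Finsupp.notMem_support_iff.1 this, sub_zero]
    calc l1 (v - v') ≤ ∑ b ∈ Finset.range M, ‖(v - v') b‖ :=
          Finset.sum_le_sum_of_subset_of_nonneg hsub fun _ _ _ => norm_nonneg _
      _ ≤ (Finset.range M).card • η := Finset.sum_le_card_nsmul _ _ _ fun b hb => by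
          have h1 : (v - v') b = coord b (emb v - w) := by
            rw [map_sub, hw0 b (Finset.mem_range.1 hb), hcoord, sub_zero, Finsupp.sub_apply, hv',
              restrict_apply, if_neg (fun h => (Finset.mem_sdiff.1 h).2 hb), sub_zero]
            rfl
          rw [h1]
          exact (hcoord_le b _).trans (by linarith)
      _ = M * η := by simp
  have hdist : ‖emb v' - w‖ ≤ (M + 1) * η := by
    have h1 : emb v' - w = (emb v - w) - emb (v - v') := by rw [map_sub]; abel
    rw [h1]
    refine (norm_sub_le _ _).trans ?_
    rw [norm_emb]
    linarith
  have hnorm : |schlumprechtNorm v' - 1| ≤ (M + 1) * η := by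
    have h := abs_norm_sub_norm_le (emb v') w
    rw [norm_emb, hw1] at h
    exact h.trans hdist
  have hpos : 0 < schlumprechtNorm v' := by linarith [(abs_le.1 hnorm).1]
  set t := schlumprechtNorm v' with ht
  have htc : ‖(t : ℂ)⁻¹‖ = t⁻¹ := by
    rw [norm_inv, Complex.norm_real, Real.norm_of_nonneg hpos.le]
  refine ⟨(t : ℂ)⁻¹ • v', ?_, fun b hb => ?_, w, hwW, ?_⟩
  · rw [schlumprechtNorm_smul, htc, inv_mul_cancel₀ hpos.ne']
  · have h1 := Finsupp.support_smul hb
    rw [hv', support_restrict, Finset.mem_inter, Finset.mem_sdiff, Finset.mem_range, not_lt] at h1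
    exact h1.2.2
  · have h1 : ‖emb ((t : ℂ)⁻¹ • v') - emb v'‖ ≤ (M + 1) * η := by
      rw [← map_sub, norm_emb]
      have h2 : (t : ℂ)⁻¹ • v' - v' = ((t : ℂ)⁻¹ * (1 - t : ℝ)) • v' := by
        have h3 : (t : ℂ) ≠ 0 := by exact_mod_cast hpos.ne'
        rw [Complex.ofReal_sub, mul_sub, inv_mul_cancel₀ h3, Complex.ofReal_one, mul_one, sub_smul,
          one_smul]
      rw [h2, schlumprechtNorm_smul, norm_mul, htc, ← ht, Complex.norm_real, Real.norm_eq_abs,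
        abs_sub_comm, mul_right_comm, inv_mul_cancel₀ hpos.ne', one_mul]
      exact hnorm
    calc ‖emb ((t : ℂ)⁻¹ • v') - w‖
        ≤ ‖emb ((t : ℂ)⁻¹ • v') - emb v'‖ + ‖emb v' - w‖ := norm_sub_le_norm_sub_add_norm_sub _ _ _
      _ ≤ δ := by linarith

lemma exists_normalizedBlock {W : Submodule ℂ SchlumprechtSpace} (hW : ¬ FiniteDimensional ℂ W) :
    ∃ (x : ℕ → ℕ →₀ ℂ) (w : ℕ → SchlumprechtSpace), IsNormalizedBlock x ∧ (∀ k, w k ∈ W) ∧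
      ∀ k, ‖emb (x k) - w k‖ ≤ (1 / 2) ^ (k + 3) := by
  obtain ⟨p, hp, hpr⟩ := exists_seq_of_forall_finset_exists
    (fun p : (ℕ →₀ ℂ) × SchlumprechtSpace × ℕ => schlumprechtNorm p.1 = 1 ∧ p.2.1 ∈ W ∧
      ‖emb p.1 - p.2.1‖ ≤ (1 / 2) ^ (p.2.2 + 3))
    (fun p q => Before p.1.support q.1.support ∧ p.2.2 < q.2.2) (fun S _ => by
    classical
    obtain ⟨M, hM⟩ := (S.biUnion fun p => insert p.2.2 p.1.support).exists_le
    have hM' : ∀ q ∈ S, ∀ i ∈ insert q.2.2 q.1.support, i ≤ M := fun q hq i hi =>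
      hM i (Finset.mem_biUnion.2 ⟨q, hq, hi⟩)
    obtain ⟨x, hx, hxM, w, hw, hxw⟩ := exists_near_of_not_finiteDimensional hW (M + 1)
      (show (0 : ℝ) < (1 / 2) ^ (M + 1 + 3) by positivity)
    refine ⟨(x, w, M + 1), ⟨hx, hw, hxw⟩, fun q hq => ⟨fun b hb b' hb' => ?_, ?_⟩⟩
    · exact Nat.lt_of_lt_of_le (Nat.lt_succ_of_le (hM' q hq b (Finset.mem_insert_of_mem hb)))
        (hxM b' hb')
    · exact Nat.lt_succ_of_le (hM' q hq _ (Finset.mem_insert_self _ _)))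
  have hm : StrictMono fun i => (p i).2.2 := fun i j hij => (hpr i j hij).2
  refine ⟨fun i => (p i).1, fun i => (p i).2.1, ⟨fun i j hij => (hpr i j hij).1, fun i => (hp i).1⟩,
    fun i => (hp i).2.1, fun i => (hp i).2.2.trans ?_⟩
  exact pow_le_pow_of_le_one (by norm_num) (by norm_num) (Nat.add_le_add_right hm.le_apply 3)

/-- Every infinite-dimensional subspace contains small perturbations of rapidly increasing
averages. -/
lemma exists_isRapid_near {W : Submodule ℂ SchlumprechtSpace} (hW : ¬ FiniteDimensional ℂ W) :
    ∃ (y : ℕ → ℕ →₀ ℂ) (n : ℕ → ℕ) (w : ℕ → SchlumprechtSpace), IsRapid y n ∧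
      (∀ i, schlumprechtNorm (y i) = 1) ∧ (∀ i, w i ∈ W) ∧
      ∀ i, ‖emb (y i) - w i‖ ≤ (1 / 2) ^ (i + 2) := by
  obtain ⟨x, w, hx, hw, hxw⟩ := exists_normalizedBlock hW
  obtain ⟨c, n, hr, h1, hc⟩ := hx.exists_isRapid
  refine ⟨fun i => comb x (c i), n, fun i => ∑ k ∈ (c i).support, c i k • w k, hr, h1,
    fun i => W.sum_mem fun k _ => W.smul_mem _ (hw k), fun i => ?_⟩
  have hsub : ∃ m, (c i).support ⊆ Finset.Ico i m := by
    obtain ⟨m, hm⟩ := (c i).support.exists_le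
    exact ⟨m + 1, fun k hk => Finset.mem_Ico.2 ⟨hc i k hk, Nat.lt_succ_of_le (hm k hk)⟩⟩
  obtain ⟨m, hm⟩ := hsub
  simp only
  rw [comb_eq_sum x subset_rfl, map_sum, ← Finset.sum_sub_distrib]
  calc ‖∑ k ∈ (c i).support, (emb (c i k • x k) - c i k • w k)‖
      ≤ ∑ k ∈ (c i).support, ‖emb (c i k • x k) - c i k • w k‖ := norm_sum_le _ _
    _ ≤ ∑ k ∈ (c i).support, (1 / 2 : ℝ) ^ (k + 3) := Finset.sum_le_sum fun k _ => by
        rw [map_smul, ← smul_sub, norm_smul]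
        exact (mul_le_of_le_one_left (norm_nonneg _)
          ((hx.norm_apply_le (c i) k).trans (h1 i).le)).trans (hxw k)
    _ ≤ ∑ k ∈ Finset.Ico i m, (1 / 2 : ℝ) ^ (k + 3) :=
        Finset.sum_le_sum_of_subset_of_nonneg hm fun k _ _ => by positivity
    _ = (∑ k ∈ Finset.Ico i m, (1 / 2 : ℝ) ^ k) * (1 / 2) ^ 3 := by
        rw [Finset.sum_mul]
        exact Finset.sum_congr rfl fun k _ => pow_add _ _ _
    _ ≤ ((1 / 2 : ℝ) ^ i / (1 - 1 / 2)) * (1 / 2) ^ 3 :=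
        mul_le_mul_of_nonneg_right (geom_sum_Ico_le_of_lt_one (by norm_num) (by norm_num))
          (by norm_num)
    _ = (1 / 2) ^ (i + 2) := by rw [pow_add]; ring

end Subspaces

/-! ### Complementable minimality of Schlumprecht's space -/

section Minimality

open Classical in
/-- The image of the basis vector `e b` under the map of `exists_coefficient_map`. -/
noncomputable def coefficientVector (y : ℕ → ℕ →₀ ℂ) (g : ℕ → SchlumprechtSpace →L[ℂ] ℂ) (b : ℕ) :
    ℕ →₀ ℂ :=
  if h : ∃ i, b ∈ (y i).support then
    Finsupp.single h.choose (g h.choose (emb (Finsupp.single b 1))) else 0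

lemma coefficientVector_apply {y : ℕ → ℕ →₀ ℂ}
    (hy : ∀ i j, i < j → Before (y i).support (y j).support)
    (g : ℕ → SchlumprechtSpace →L[ℂ] ℂ) (b i : ℕ) :
    coefficientVector y g b i = g i (emb (restrict (y i).support (Finsupp.single b 1))) := by
  classical
  have huniq : ∀ i j, b ∈ (y i).support → b ∈ (y j).support → i = j := by
    intro i j hi hj
    rcases lt_trichotomy i j with h | h | h
    · exact absurd (hy i j h b hi b hj) (lt_irrefl _)
    · exact h
    · exact absurd (hy j i h b hj b hi) (lt_irrefl _)
  by_cases hb : b ∈ (y i).support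
  · have h : ∃ i, b ∈ (y i).support := ⟨i, hb⟩
    rw [coefficientVector, dif_pos h, huniq _ _ h.choose_spec hb, Finsupp.single_eq_same,
      restrict_of_support_subset]
    exact Finsupp.support_single_subset.trans (Finset.singleton_subset_iff.2 hb)
  · rw [restrict_eq_zero, map_zero, map_zero, coefficientVector]
    · split_ifs with h
      · exact Finsupp.single_eq_of_ne fun h' => hb (h' ▸ h.choose_spec)
      · rfl
    · intro c hc hc'
      rw [Finset.mem_singleton.1 (Finsupp.support_single_subset hc')] at hc
      exact hb hc

/-- For a block sequence `y` and functionals `g` of norm at most one, `x ↦ (g i (x|supp (y i)))ᵢ`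
is a contraction. -/
lemma exists_coefficient_map {y : ℕ → ℕ →₀ ℂ}
    (hy : ∀ i j, i < j → Before (y i).support (y j).support)
    {g : ℕ → SchlumprechtSpace →L[ℂ] ℂ} (hg : ∀ i, ‖g i‖ ≤ 1) :
    ∃ B : SchlumprechtSpace →L[ℂ] SchlumprechtSpace, (∀ z, ‖B z‖ ≤ ‖z‖) ∧
      ∀ x, ∃ b : ℕ →₀ ℂ, B (emb x) = emb b ∧ ∀ i, b i = g i (emb (restrict (y i).support x)) := by
  let B₀ : (ℕ →₀ ℂ) →ₗ[ℂ] (ℕ →₀ ℂ) := Finsupp.linearCombination ℂ (coefficientVector y g)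
  have hB₀ : ∀ x i, B₀ x i = g i (emb (restrict (y i).support x)) := by
    intro x i
    have h : Finsupp.lapply i ∘ₗ B₀ = (g i).toLinearMap ∘ₗ emb ∘ₗ restrictₗ (y i).support := by
      refine Finsupp.lhom_ext' fun b => LinearMap.ext_ring ?_
      simp [B₀, coefficientVector_apply hy, restrictₗ_apply]
    exact LinearMap.congr_fun h x
  have hle : ∀ x, schlumprechtNorm (B₀ x) ≤ schlumprechtNorm x := fun x =>
    schlumprechtNorm_le_of_norm_apply_le hy fun i => by
      rw [hB₀, ← norm_emb]
      exact (g i).le_of_opNorm_le_of_le (hg i) le_rfl |>.trans (one_mul _).le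
  obtain ⟨B, hB, hB1⟩ := exists_extension (emb ∘ₗ B₀) 1 fun x => by
    rw [one_mul, LinearMap.comp_apply, norm_emb]
    exact hle x
  exact ⟨B, fun z => by simpa using hB1 z, fun x => ⟨B₀ x, hB x, hB₀ x⟩⟩

lemma sum_norm_mul_le (a : ℕ →₀ ℂ) :
    ∑ i ∈ a.support, ‖a i‖ * (1 / 2 : ℝ) ^ (i + 2) ≤ 1 / 2 * schlumprechtNorm a := by
  calc ∑ i ∈ a.support, ‖a i‖ * (1 / 2 : ℝ) ^ (i + 2)
      ≤ ∑ i ∈ a.support, schlumprechtNorm a * ((1 / 2 : ℝ) ^ i * (1 / 4)) :=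
        Finset.sum_le_sum fun i _ => by
          rw [pow_add]
          norm_num only
          exact mul_le_mul_of_nonneg_right (norm_apply_le_schlumprechtNorm a i) (by positivity)
    _ = schlumprechtNorm a * ((∑ i ∈ a.support, (1 / 2 : ℝ) ^ i) * (1 / 4)) := by
        rw [Finset.sum_mul, Finset.mul_sum]
    _ ≤ schlumprechtNorm a * (2 * (1 / 4)) := by
        refine mul_le_mul_of_nonneg_left (mul_le_mul_of_nonneg_right ?_ (by norm_num))
          (schlumprechtNorm_nonneg a)
        exact (summable_geometric_two.sum_le_tsum _ fun i _ => by positivity).trans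
          tsum_geometric_two.le
    _ = 1 / 2 * schlumprechtNorm a := by ring

/-- Schlumprecht's space is complementably minimal: small perturbations `w i ∈ W` of rapidly
increasing averages `y i` span a copy of the space by the upper estimate, and norming functionals
of the `y i` provide a left inverse of the embedding. -/
theorem complementablyMinimal : ComplementablyMinimal SchlumprechtSpace := by
  intro W hWc hW
  obtain ⟨y, n, w, hy, hy1, hwW, hyw⟩ := exists_isRapid_near hW
  obtain ⟨C, hC⟩ := IsRapid.schlumprechtNorm_comb_le
  choose g hg hgy using fun i => exists_dual_vector'' ℂ (emb (y i))
  obtain ⟨B, hB, hB'⟩ := exists_coefficient_map hy.before hg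
  have hpert : ∀ a : ℕ →₀ ℂ, ‖∑ i ∈ a.support, a i • (w i - emb (y i))‖ ≤
      1 / 2 * schlumprechtNorm a := fun a => by
    refine (norm_sum_le _ _).trans (le_trans (Finset.sum_le_sum fun i _ => ?_) (sum_norm_mul_le a))
    rw [norm_smul, norm_sub_rev]
    exact mul_le_mul_of_nonneg_left (hyw i) (norm_nonneg _)
  have hdecomp : ∀ a : ℕ →₀ ℂ, Finsupp.linearCombination ℂ w a =
      emb (comb y a) + ∑ i ∈ a.support, a i • (w i - emb (y i)) := fun a => by
    rw [comb_eq_sum y subset_rfl, map_sum, ← Finset.sum_add_distrib,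
      Finsupp.linearCombination_apply, Finsupp.sum]
    refine Finset.sum_congr rfl fun i _ => ?_
    rw [map_smul, smul_sub, add_sub_cancel]
  obtain ⟨T, hT, -⟩ := exists_extension (Finsupp.linearCombination ℂ w) (C + 1 / 2) fun a => by
    rw [hdecomp, add_mul]
    refine (norm_add_le _ _).trans (add_le_add ?_ (hpert a))
    rw [norm_emb]
    exact hC y n hy a
  have hTW : ∀ z, T z ∈ W := fun z => by
    refine denseRange_emb.induction_on (p := fun z => T z ∈ W) z
      (hWc.preimage T.continuous) fun a => ?_
    rw [hT, Finsupp.linearCombination_apply]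
    exact W.sum_mem fun i _ => W.smul_mem _ (hwW i)
  have hBy : ∀ a, B (emb (comb y a)) = emb a := fun a => by
    obtain ⟨b, hb, hbi⟩ := hB' (comb y a)
    rw [hb]
    congr 1
    ext i
    rw [hbi, restrict_support_comb hy.before, map_smul, map_smul, hgy, norm_emb, hy1]
    simp
  have hBT : ‖1 - B * T‖ < 1 := by
    refine lt_of_le_of_lt (norm_le_of_comp_emb _ (by norm_num) fun a => ?_)
      (by norm_num : (1 / 2 : ℝ) < 1)
    have h : (1 - B * T) (emb a) = -B (∑ i ∈ a.support, a i • (w i - emb (y i))) := by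
      rw [sub_apply, mul_apply_eq_comp, hT, hdecomp, map_add, hBy]
      simp
    rw [h, norm_neg]
    exact (hB _).trans (hpert a)
  obtain ⟨U, hU⟩ := isUnit_one_sub_of_norm_lt_one hBT
  rw [sub_sub_cancel] at hU
  have hV : ∀ z, ((↑U⁻¹ : SchlumprechtSpace →L[ℂ] SchlumprechtSpace) * B) (T z) = z := fun z => by
    have h : (↑U⁻¹ : SchlumprechtSpace →L[ℂ] SchlumprechtSpace) * (B * T) = 1 := by
      rw [← hU, Units.inv_mul]
    exact DFunLike.congr_fun h z
  have h := complemented_range_of_leftInverse T _ hV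
  refine ⟨_, ?_, h⟩
  rintro _ ⟨z, rfl⟩
  exact hTW z

end Minimality

end Schlumprecht

theorem theorem1p5 :
    (∀ (X : Type u) [NormedAddCommGroup X] [NormedSpace ℂ X] [CompleteSpace X],
      ComplementablyMinimal X → HasComplementedSquare X → HasSHAI.{u, v} X) ∧
    HasSHAI.{0, v} SchlumprechtSpace :=
  ⟨fun _ _ _ _ hmin hsq => hasSHAI_of_complementablyMinimal hmin hsq,
    hasSHAI_of_complementablyMinimal Schlumprecht.complementablyMinimal
      Schlumprecht.hasComplementedSquare⟩
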